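/- Let $k,\ell\ge 1$ be integers. In the $k$-semi-random graph process on $[n]$, one starts with the empty multigraph $G_0$. In each round $t\ge1$, $k$ vertices $u_t^1,\dots,u_t^k$ are drawn independently and uniformly at random from $[n]$; the player selects one of them, $u_t=u_t^{i_t}$ with $i_t\in[k]$, and any vertex $v_t\in[n]$, and the edge $u_tv_t$ is added to $G_{t-1}$ to form $G_t$ (loops, which count twice in the degree, and parallel edges are allowed). A strategy $\mathcal S$ specifies, for each $t$, a probability distribution on $[k]\times[n]$ as a function of $u_1,v_1,\dots,u_{t-1},v_{t-1},u_t^1,\dots,u_t^k$, from which $(i_t,v_t)$ is drawn. Let $\mathcal P_\ell$ be the property of having minimum degree at least $\ell$. For $0<p<1$ let $\hat\tau_{\mathcal P_\ell}(\mathcal S,p,n,k)\in\{0,1,\dots\}\cup\{\infty\}$ be the least $t\ge0$ such that $\mathbb P[G_t\in\mathcal P_\ell]\ge p$ under $\mathcal S$, let $\hat\tau_{\mathcal P_\ell}(p,n,k)=\inf_{\mathcal S}\hat\tau_{\mathcal P_\ell}(\mathcal S,p,n,k)$, and $$\tau_{\mathcal P_\ell}(k)=\lim_{p\to1^-}\ \limsup_{n\to\infty}\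 \frac{\hat\tau_{\mathcal P_\ell}(p,n,k)}{n}.$$ Consider the following system with $\ell$ phases for functions $y_0,\dots,y_{\ell-1}$ and times $0=x_{-1}<x_0<\dots<x_{\ell-1}$. Initially $y_0(0)=1$ and $y_i(0)=0$ for $1\le i\le\ell-1$. For $q=0,\dots,\ell-1$, in phase $q$ the functions $y_i$, $q\le i\le \ell-1$, are continuous on $[x_{q-1},x_q]$ and satisfy on $(x_{q-1},x_q)$ $$y_i'=-\delta_{i=q}+\delta_{i=q+1}-\Big(\Big(1-\sum_{a=q}^{i-1}y_a\Big)^k-\Big(1-\sum_{a=q}^{i}y_a\Big)^k\Big)+\delta_{i\ge q+1}\Big(\Big(1-\sum_{a=q}^{i-2}y_a\Big)^k-\Big(1-\sum_{a=q}^{i-1}y_a\Big)^k\Big),$$ where $\delta_A$ is $1$ if $A$ holds and $0$ otherwise, and $x_q>x_{q-1}$ is the first zero of $y_q$ in phase $q$, that is, $y_q>0$ on $[x_{q-1},x_q)$ and $y_q(x_q)=0$; the values $y_i(x_q)$ are the initial values for phase $q+1$. Theorem. For all $k,\ell\ge1$ this system has a solution, and all its solutions have the same final time $x_{\ell-1}=:c_{\ell,k}$.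 Moreover $$\tau_{\mathcal P_\ell}(k)=c_{\ell,k}\qquad\text{and}\qquad c_{\ell,k}\ge \ell/2 .$$ For $1\le k,\ell\le5$ the values of $c_{\ell,k}$, rounded to five decimal places (so with an error of at most $5\cdot10^{-6}$), are | | $k=1$ | $k=2$ | $k=3$ | $k=4$ | $k=5$ | |---|---|---|---|---|---| | $\ell=1$ | 0.69315 | 0.62323 | 0.59072 | 0.57183 | 0.55947 | | $\ell=2$ | 1.21974 | 1.12498 | 1.09081 | 1.07184 | 1.05947 | | $\ell=3$ | 1.73164 | 1.62508 | 1.59081 | 1.57184 | 1.55947 | | $\ell=4$ | 2.23812 | 2.12508 | 2.09081 | 2.07184 | 2.05947 | | $\ell=5$ | 2.74200 | 2.62508 | 2.59081 | 2.57184 | 2.55947 | -/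

import Mathlib

open Filter Topology
open scoped ENNReal

noncomputable section

namespace SemiRandom

/-- A multigraph on the vertex set `Fin n` (loops and parallel edges allowed): the multiset of its
edges. -/
abbrev MultiGraph (n : ℕ) : Type := Multiset (Sym2 (Fin n))

/-- The degree of `v`: every edge counts as often as `v` is an endpoint of it, so a loop counts
twice and parallel edges count separately. -/
def degree {n : ℕ} (G : MultiGraph n) (v : Fin n) : ℕ :=
  (G.map fun e => e.toMultiset.count v).sum

/-- The property that the minimum degree is at least `ℓ`. -/
def MinDegreeAtLeast (ℓ : ℕ) (n : ℕ) (G : MultiGraph n) : Prop :=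
  ∀ v : Fin n, ℓ ≤ degree G v

/-- The history `(u₁, v₁), …, (u_t, v_t)` of the first `t` rounds: the chosen square and the circle
of each round. -/
abbrev History (n t : ℕ) : Type := Fin t → Fin n × Fin n

/-- The multigraph `G_t` with edges `u₁v₁, …, u_tv_t`. -/
def History.graph {n t : ℕ} (h : History n t) : MultiGraph n :=
  Finset.univ.val.map fun s : Fin t => s((h s).1, (h s).2)

/-- A (randomized) strategy against the `k`-process on `n` vertices: from the history of the first
`t` rounds and the `k` squares offered in the next round, a distribution of the pair
(index of the selected square, circle). -/
abbrev Strategy (k n : ℕ) : Type :=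
  (t : ℕ) → History n t → (Fin k → Fin n) → PMF (Fin k × Fin n)

/-- The law of the history after `t` rounds. In each round, `k` independent uniform vertices are
offered, that is, a uniformly random element `w` of `Fin k → Fin n`. -/
def historyLaw {k n : ℕ} [NeZero n] (S : Strategy k n) : (t : ℕ) → PMF (History n t)
  | 0 => PMF.pure Fin.elim0
  | t + 1 =>
    (historyLaw S t).bind fun h =>
      (PMF.uniformOfFintype (Fin k → Fin n)).bind fun w =>
        (S t h w).map fun p => Fin.snoc h (w p.1, p.2)

/-- The law of the random multigraph `G_t`. -/
def graphLaw {k n : ℕ} [NeZero n] (S : Strategy k n) (t : ℕ) : PMF (MultiGraph n) :=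
  (historyLaw S t).map History.graph

/-- The least `t` such that `G_t` has the property `P` with probability at least `p`, under the
strategy `S`; it is `⊤` if there is no such `t`. -/
def hitTimeWith {k n : ℕ} [NeZero n] (P : ∀ n, MultiGraph n → Prop) (S : Strategy k n) (p : ℝ) :
    ℕ∞ :=
  ⨅ (t : ℕ) (_ : ENNReal.ofReal p ≤ (graphLaw S t).toOuterMeasure {G | P n G}), (t : ℕ∞)

/-- The infimum of `hitTimeWith` over all strategies. -/
def hitTime (P : ∀ n, MultiGraph n → Prop) (p : ℝ) (n k : ℕ) [NeZero n] : ℕ∞ :=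
  ⨅ S : Strategy k n, hitTimeWith P S p

/-- The upper limit of `hitTime P p n k / n` as `n → ∞` (over `n ≥ 1`). -/
def upperRate (P : ∀ n, MultiGraph n → Prop) (k : ℕ) (p : ℝ) : ℝ≥0∞ :=
  limsup (fun m : ℕ => (hitTime P p (m + 1) k : ℝ≥0∞) / ((m + 1 : ℕ) : ℝ≥0∞)) atTop

/-- `τ_P(k) = c`, where `τ_P(k)` is the limit of `upperRate P k p` as `p → 1` from below. -/
def TauEq (P : ∀ n, MultiGraph n → Prop) (k : ℕ) (c : ℝ≥0∞) : Prop :=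
  Tendsto (upperRate P k) (𝓝[<] 1) (𝓝 c)

/-- The right-hand side of the differential equation for `y_i` in phase `q`, for `q ≤ i`. -/
def phaseRHS (k q i : ℕ) (y : ℕ → ℝ) : ℝ :=
  -(if i = q then 1 else 0) + (if i = q + 1 then 1 else 0)
    - ((1 - ∑ a ∈ Finset.Ico q i, y a) ^ k - (1 - ∑ a ∈ Finset.Icc q i, y a) ^ k)
    + (if q + 1 ≤ i then
        (1 - ∑ a ∈ Finset.Ico q (i - 1), y a) ^ k - (1 - ∑ a ∈ Finset.Ico q i, y a) ^ k
      else 0)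

/-- `y_0, …, y_{ℓ-1}` solve the phase-by-phase system. Phase `q` (for `q < ℓ`) is the interval
`[X q, X (q + 1)]`; it starts where the previous phase ends, with the final values of the previous
phase as initial values, and it ends at the first zero of `y_q`. -/
structure IsPhaseSolution (k ℓ : ℕ) (X : ℕ → ℝ) (y : ℕ → ℝ → ℝ) : Prop where
  start : X 0 = 0
  init : ∀ i < ℓ, y i 0 = if i = 0 then 1 else 0
  lt : ∀ q < ℓ, X q < X (q + 1)
  cont : ∀ q < ℓ, ∀ i, q ≤ i → i < ℓ → ContinuousOn (y i) (Set.Icc (X q) (X (q + 1)))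
  ode : ∀ q < ℓ, ∀ i, q ≤ i → i < ℓ → ∀ x ∈ Set.Ioo (X q) (X (q + 1)),
    HasDerivAt (y i) (phaseRHS k q i fun a => y a x) x
  pos : ∀ q < ℓ, ∀ x ∈ Set.Ico (X q) (X (q + 1)), 0 < y q x
  zero : ∀ q < ℓ, y q (X (q + 1)) = 0

/-- `c` is the time at which the last of the `ℓ` phases ends, for some solution of the system. -/
def IsFinalTime (k ℓ : ℕ) (c : ℝ) : Prop :=
  ∃ (X : ℕ → ℝ) (y : ℕ → ℝ → ℝ), IsPhaseSolution k ℓ X y ∧ X ℓ = c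

/-- The table of numerical values; row `ℓ - 1`, column `k - 1`, for `1 ≤ k, ℓ ≤ 5`. -/
def numericalTable : Matrix (Fin 5) (Fin 5) ℝ :=
  !![0.69315, 0.62323, 0.59072, 0.57183, 0.55947;
     1.21974, 1.12498, 1.09081, 1.07184, 1.05947;
     1.73164, 1.62508, 1.59081, 1.57184, 1.55947;
     2.23812, 2.12508, 2.09081, 2.07184, 2.05947;
     2.74200, 2.62508, 2.59081, 2.57184, 2.55947]

end SemiRandom

end

noncomputable section

namespace SemiRandom

open Set

/-! ### Growth estimates from one-sided derivatives -/

/-! The proof follows truncated degree sums instead of degree counts. Let D_j be the sum of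
min(degree, j) over all vertices, divided by n (`level`). Then D_{j+1} - D_j is the fraction of
vertices of degree at least j+1, and the minimum degree is at least ℓ exactly when D_ℓ = ℓ. In one
round the circle raises n D_{j+1} by at most 1, and so does the square, which contributes nothing if
all k offered vertices already have degree at least j+1. Given the past, this event has probability
(D_{j+1} - D_j)^k. So under every strategy the drift is at most 2 - (D_{j+1} - D_j)^k, and the
greedy strategy attains this for all j at once, up to an error from loops, as long as D_{j+1} < j+1.

The fluid limit is therefore the triangular system d_{j+1}' = 2 - (d_{j+1} - d_j)^k, where d_{j+1}
is frozen at the value j+1 from the time X (j+1) on (`IsFluid`). Second differences of the d_j turn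
it into the phase system (`IsFluid.isPhaseSolution`), whose phases end at the times X (q+1).
Uniqueness for the polynomial vector field of each phase shows that every solution has these end
times (`IsPhaseSolution.time_eq`). The bound ℓ/2 holds because slopes never exceed 2.

No strategy is faster: by Jensen the means of the levels satisfy the Euler recursion of the system
as an inequality, so they stay below d_j up to O(1/n) (`IsFluid.mean_level_le`). Before X ℓ the mean
of D_ℓ is thus bounded away from ℓ, and by Markov the success probability is bounded away from 1
(`IsFluid.exists_successProb_lt`). Conversely, under the greedy strategy the second moment of the
shortfall max(0, d_j - D_j) is O(1/n) (`IsGreedy.mean_deficit_sq_le_pow`). At time X ℓ few degree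
units are then missing with high probability, and each further round supplies at least one
(`IsGreedy.missingProb_succ_le`).

The table is certified by piecewise polynomial approximations with integer coefficients. Their
residuals are bounded by exact integer arithmetic, and a comparison argument turns residuals into
error bounds (`IsFluid.le_pev`, `IsFluid.pev_le`). -/

lemma sub_le_of_right_deriv_le {f f' : ℝ → ℝ} {a b C : ℝ} (hab : a ≤ b)
    (hf : ContinuousOn f (Icc a b))
    (hf' : ∀ x ∈ Ico a b, HasDerivWithinAt f (f' x) (Ici x) x)
    (hC : ∀ x ∈ Ico a b, f' x ≤ C) : f b - f a ≤ C * (b - a) := by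
  have h := image_le_of_deriv_right_le_deriv_boundary hf hf'
    (B := fun x => f a + C * (x - a)) (B' := fun _ => C) (by simp) (by fun_prop)
    (fun x _ => by
      have h := (((hasDerivAt_id x).sub_const a).const_mul C).const_add (f a)
      simpa using h.hasDerivWithinAt) hC (right_mem_Icc.2 hab)
  linarith

lemma le_sub_of_le_right_deriv {f f' : ℝ → ℝ} {a b C : ℝ} (hab : a ≤ b)
    (hf : ContinuousOn f (Icc a b))
    (hf' : ∀ x ∈ Ico a b, HasDerivWithinAt f (f' x) (Ici x) x)
    (hC : ∀ x ∈ Ico a b, C ≤ f' x) : C * (b - a) ≤ f b - f a := by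
  have h := sub_le_of_right_deriv_le hab hf.neg (f' := fun x => -f' x) (C := -C)
    (fun x hx => (hf' x hx).neg) (fun x hx => by linarith [hC x hx])
  simp only [Pi.neg_apply] at h
  linarith

/-! ### Powers on the unit interval -/

lemma abs_pow_sub_pow_le_of_mem_Icc {k : ℕ} {a b : ℝ} (ha : a ∈ Icc (0 : ℝ) 1)
    (hb : b ∈ Icc (0 : ℝ) 1) : |a ^ k - b ^ k| ≤ k * |a - b| := by
  have h := abs_pow_sub_pow_le a b k
  have hm : max |a| |b| ≤ 1 := by
    rw [abs_of_nonneg ha.1, abs_of_nonneg hb.1]; exact max_le ha.2 hb.2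
  have h1 : max |a| |b| ^ (k - 1) ≤ 1 := pow_le_one₀ (by positivity) hm
  calc _ ≤ _ := h
    _ ≤ |a - b| * k * 1 := by gcongr
    _ = _ := by ring

lemma pow_mem_Icc {k : ℕ} {a : ℝ} (ha : a ∈ Icc (0 : ℝ) 1) : a ^ k ∈ Icc (0 : ℝ) 1 :=
  ⟨pow_nonneg ha.1 k, pow_le_one₀ ha.1 ha.2⟩

/-- The projection of the real line to the unit interval. -/
def clampUnit (x : ℝ) : ℝ := max 0 (min x 1)

lemma clampUnit_mem (x : ℝ) : clampUnit x ∈ Icc (0 : ℝ) 1 :=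
  ⟨le_max_left _ _, max_le zero_le_one (min_le_right _ _)⟩

lemma clampUnit_of_mem {x : ℝ} (hx : x ∈ Icc (0 : ℝ) 1) : clampUnit x = x := by
  rw [clampUnit, min_eq_left hx.2, max_eq_right hx.1]

lemma clampUnit_of_nonpos {x : ℝ} (hx : x ≤ 0) : clampUnit x = 0 := by
  rw [clampUnit, min_eq_left (hx.trans zero_le_one), max_eq_left hx]

lemma abs_clampUnit_sub_le (x y : ℝ) : |clampUnit x - clampUnit y| ≤ |x - y| := by
  unfold clampUnit
  refine (abs_max_sub_max_le_max _ _ _ _).trans (max_le (by simp) ?_)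
  refine (abs_min_sub_min_le_max _ _ _ _).trans (max_le le_rfl (by simp))

lemma continuous_clampUnit : Continuous clampUnit := by unfold clampUnit; fun_prop

/-! ### Saturating functions -/

/-- `g` grows from `g 0 = 0` with right derivative in `[1, 2]` up to the time `T`, and is equal to
`j` from then on. -/
structure IsSaturating (j : ℕ) (T : ℝ) (g : ℝ → ℝ) : Prop where
  nonneg : 0 ≤ T
  cont : ContinuousOn g (Ici 0)
  init : g 0 = 0
  slope : ∀ x ∈ Ico 0 T, ∃ m ∈ Icc (1 : ℝ) 2, HasDerivWithinAt g m (Ici x) x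
  saturated : ∀ x, T ≤ x → g x = j

/-- At `T` the function may have a kink, but from the right it is constant there. Right derivatives
thus exist at all times, which is why the growth estimates are phrased with them. -/
lemma IsSaturating.right_deriv {j : ℕ} {T : ℝ} {g : ℝ → ℝ} (h : IsSaturating j T g) :
    ∃ m : ℝ → ℝ, (∀ x, 0 ≤ x → HasDerivWithinAt g (m x) (Ici x) x) ∧
      (∀ x, 0 ≤ x → m x ∈ Icc (0 : ℝ) 2) ∧ ∀ x ∈ Ico 0 T, 1 ≤ m x := by
  choose! m hm hm' using h.slope
  refine ⟨fun x => if x < T then m x else 0, fun x hx => ?_, fun x hx => ?_, fun x hx => ?_⟩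
  · by_cases hT : x < T
    · simpa [hT] using hm' x ⟨hx, hT⟩
    · simp only [hT, if_false]
      exact (hasDerivWithinAt_const x (Ici x) (j : ℝ)).congr
        (fun y hy => h.saturated y ((not_lt.1 hT).trans hy)) (h.saturated x (not_lt.1 hT))
  · by_cases hT : x < T
    · simp only [hT, if_true]
      exact ⟨zero_le_one.trans (hm x ⟨hx, hT⟩).1, (hm x ⟨hx, hT⟩).2⟩
    · simp [hT]
  · simp only [hx.2, if_true]
    exact (hm x hx).1

lemma IsSaturating.monotone_sub {j : ℕ} {T : ℝ} {g : ℝ → ℝ} (h : IsSaturating j T g) {x y : ℝ}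
    (hx : 0 ≤ x) (hxy : x ≤ y) : g y - g x ∈ Icc 0 (2 * (y - x)) := by
  obtain ⟨m, hm, hm', -⟩ := h.right_deriv
  have hc : ContinuousOn g (Icc x y) := h.cont.mono fun z hz => hx.trans hz.1
  have h1 := sub_le_of_right_deriv_le hxy hc (fun z hz => hm z (hx.trans hz.1))
    (fun z hz => (hm' z (hx.trans hz.1)).2)
  have h2 := le_sub_of_le_right_deriv hxy hc (fun z hz => hm z (hx.trans hz.1))
    (fun z hz => (hm' z (hx.trans hz.1)).1)
  exact ⟨by linarith, h1⟩

lemma IsSaturating.le_sub {j : ℕ} {T : ℝ} {g : ℝ → ℝ} (h : IsSaturating j T g) {x y : ℝ}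
    (hx : 0 ≤ x) (hxy : x ≤ y) (hy : y ≤ T) : y - x ≤ g y - g x := by
  obtain ⟨m, hm, -, hm'⟩ := h.right_deriv
  have hc : ContinuousOn g (Icc x y) := h.cont.mono fun z hz => hx.trans hz.1
  have h2 := le_sub_of_le_right_deriv hxy hc (fun z hz => hm z (hx.trans hz.1))
    (fun z hz => hm' z ⟨hx.trans hz.1, hz.2.trans_le hy⟩)
  linarith

lemma IsSaturating.time_le {j : ℕ} {T : ℝ} {g : ℝ → ℝ} (h : IsSaturating j T g) : T ≤ j := by
  have := h.le_sub le_rfl h.nonneg le_rfl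
  rw [h.init, h.saturated T le_rfl] at this
  linarith

/-- An edge raises the degree sum by 2, so the slope is at most 2 and climbing to `j` takes time at
least `j / 2`. This is the source of the bound ℓ/2. -/
lemma IsSaturating.le_two_mul_time {j : ℕ} {T : ℝ} {g : ℝ → ℝ} (h : IsSaturating j T g) :
    (j : ℝ) / 2 ≤ T := by
  have := (h.monotone_sub le_rfl h.nonneg).2
  rw [h.init, h.saturated T le_rfl] at this
  linarith

lemma IsSaturating.lt_of_lt {j : ℕ} {T : ℝ} {g : ℝ → ℝ} (h : IsSaturating j T g) {x : ℝ}
    (hx : 0 ≤ x) (hxT : x < T) : g x < j := by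
  have := h.le_sub hx hxT.le le_rfl
  rw [h.saturated T le_rfl] at this
  linarith

lemma IsSaturating.le {j : ℕ} {T : ℝ} {g : ℝ → ℝ} (h : IsSaturating j T g) {x : ℝ}
    (hx : 0 ≤ x) : g x ≤ j := by
  rcases lt_or_ge x T with hxT | hxT
  · exact (h.lt_of_lt hx hxT).le
  · exact (h.saturated x hxT).le

/-- `f` solves `f' = 2 - (f - g) ^ k` up to the time `T'`, and stays between `g` and `g + 1`. -/
structure Follows (k : ℕ) (g : ℝ → ℝ) (T' : ℝ) (f : ℝ → ℝ) : Prop where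
  right_deriv : ∀ x ∈ Ico 0 T', HasDerivWithinAt f (2 - (f x - g x) ^ k) (Ici x) x
  deriv : ∀ x ∈ Ioo 0 T', HasDerivAt f (2 - (f x - g x) ^ k) x
  gap_nonneg : ∀ x, 0 ≤ x → 0 ≤ f x - g x
  gap_lt : ∀ x ∈ Ico 0 T', f x - g x < 1

/-- Clamping the gap to the unit interval makes the field globally `k`-Lipschitz in `x` and bounded
by 2, so Picard–Lindelöf gives a solution on the whole of `[0, b]` at once. The clamp becomes void
once the gap is known to stay in the unit interval. -/
lemma exists_clamped_solution (k : ℕ) {g : ℝ → ℝ} (hg : ContinuousOn g (Ici 0)) {b : ℝ}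
    (hb : 0 ≤ b) : ∃ f : ℝ → ℝ, f 0 = 0 ∧ ∀ t ∈ Icc 0 b,
      HasDerivWithinAt f (2 - clampUnit (f t - g t) ^ k) (Icc 0 b) t := by
  have hP : IsPicardLindelof (fun t x => 2 - clampUnit (x - g t) ^ k)
      (⟨0, left_mem_Icc.2 hb⟩ : Icc 0 b) (0 : ℝ) ⟨2 * b, by positivity⟩ 0 2 k := by
    refine ⟨fun t _ => ?_, fun x _ => ?_, fun t _ x _ => ?_, ?_⟩
    · refine LipschitzOnWith.of_dist_le_mul fun x _ y _ => ?_
      rw [Real.dist_eq, Real.dist_eq]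
      calc |2 - clampUnit (x - g t) ^ k - (2 - clampUnit (y - g t) ^ k)|
          = |clampUnit (x - g t) ^ k - clampUnit (y - g t) ^ k| := by
            rw [← abs_neg]; congr 1; ring
        _ ≤ k * |clampUnit (x - g t) - clampUnit (y - g t)| :=
            abs_pow_sub_pow_le_of_mem_Icc (clampUnit_mem _) (clampUnit_mem _)
        _ ≤ k * |x - y| := by
            refine mul_le_mul_of_nonneg_left ?_ (Nat.cast_nonneg k)
            refine (abs_clampUnit_sub_le _ _).trans (le_of_eq ?_)
            congr 1; ring
        _ = _ := by simp
    · have : ContinuousOn g (Icc 0 b) := hg.mono Icc_subset_Ici_self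
      exact continuousOn_const.sub
        ((continuous_clampUnit.comp_continuousOn (continuousOn_const.sub this)).pow k)
    · have := pow_mem_Icc (k := k) (clampUnit_mem (x - g t))
      rw [Real.norm_eq_abs, abs_of_nonneg (by linarith [this.2])]
      have := this.1
      simp only [NNReal.coe_ofNat]
      linarith
    · simp only [sub_zero, sub_self, NNReal.coe_ofNat, NNReal.coe_zero]
      rw [max_eq_left hb]
      exact le_rfl
  obtain ⟨f, hf0, hf⟩ := hP.exists_eq_forall_mem_Icc_hasDerivWithinAt₀
  exact ⟨f, hf0, hf⟩

/-- The clamped solution is shown to have its gap in `[0, 1)` up to the first time `T'` at which it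
equals `j + 1`, and is frozen from then on. Since the gap is still below 1 when `g` saturates at
`T`, it follows that `T < T'`. -/
lemma IsSaturating.exists_follows {k : ℕ} (hk : 1 ≤ k) {j : ℕ} {T : ℝ} {g : ℝ → ℝ}
    (h : IsSaturating j T g) :
    ∃ (T' : ℝ) (f : ℝ → ℝ), T < T' ∧ IsSaturating (j + 1) T' f ∧ Follows k g T' f := by
  -- The slope of `f` is at least 1, so `f` passes `j + 1` before the time `j + 2`; also `T ≤ j <
  -- b`.
  set b : ℝ := j + 2 with hb
  have hb0 : 0 ≤ b := by positivity
  obtain ⟨f, hf0, hf⟩ := exists_clamped_solution k h.cont hb0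
  have hTj := h.time_le
  have hT0 := h.nonneg
  have hfc : ContinuousOn f (Icc 0 b) := fun x hx => (hf x hx).continuousWithinAt
  have hfr : ∀ x ∈ Ico 0 b, HasDerivWithinAt f (2 - clampUnit (f x - g x) ^ k) (Ici x) x :=
    fun x hx => (hf x (Ico_subset_Icc_self hx)).mono_of_mem_nhdsWithin
      (mem_of_superset (Icc_mem_nhdsGE hx.2) (Icc_subset_Icc_left hx.1))
  have hcl : ∀ x, clampUnit (f x - g x) ^ k ∈ Icc (0 : ℝ) 1 := fun x =>
    pow_mem_Icc (clampUnit_mem _)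
  have hinc : ∀ x y, 0 ≤ x → x ≤ y → y ≤ b → y - x ≤ f y - f x := fun x y hx hxy hy => by
    have := le_sub_of_le_right_deriv (C := 1) hxy (hfc.mono (Icc_subset_Icc hx hy))
      (fun z hz => hfr z ⟨hx.trans hz.1, hz.2.trans_le hy⟩)
      (fun z _ => by linarith [(hcl z).2])
    linarith
  obtain ⟨m, hm, hm', hm1⟩ := h.right_deriv
  have hgc : ContinuousOn g (Icc 0 b) := h.cont.mono Icc_subset_Ici_self
  have hzr : ∀ x ∈ Ico 0 b, HasDerivWithinAt (fun x => f x - g x)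
      (2 - clampUnit (f x - g x) ^ k - m x) (Ici x) x := fun x hx => (hfr x hx).sub (hm x hx.1)
  have hz0 : ∀ x ∈ Icc 0 b, 0 ≤ f x - g x := by
    intro x hx
    -- The comparison lemma wants a strict inequality of slopes at contact, hence the slack `ε * x`.
    -- Where the gap is nonpositive its clamped power is 0, as `k ≥ 1`, so the slope of the gap is
    -- `2 - m y ≥ 0`.
    have key : ∀ ε > 0, -(f x - g x) ≤ ε * x := by
      intro ε hε
      refine image_le_of_deriv_right_lt_deriv_boundary (a := 0) (b := b)
        (f := fun x => -(f x - g x)) (B := fun x => ε * x) (B' := fun _ => ε)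
        (hfc.sub hgc).neg (fun y hy => (hzr y hy).neg) (by simp [hf0, h.init])
        (fun y => by simpa using (hasDerivAt_id y).const_mul ε) (fun y hy hyB => ?_) hx
      have : f y - g y ≤ 0 := by
        have := mul_nonneg hε.le hy.1
        linarith
      rw [clampUnit_of_nonpos this, zero_pow (by omega)]
      linarith [(hm' y hy.1).2]
    have hx0 : 0 ≤ x := hx.1
    by_contra hneg
    push Not at hneg
    rcases hx0.eq_or_lt with rfl | hxpos
    · simp [hf0, h.init] at hneg
    · have := key (-(f x - g x) / (2 * x)) (div_pos (by linarith) (by linarith))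
      rw [div_mul_eq_mul_div, le_div_iff₀ (by linarith)] at this
      nlinarith
  have hz1 : ∀ x ∈ Icc 0 T, f x - g x < 1 := by
    intro x hx
    have hTb : T ≤ b := by linarith
    -- The barrier is 1 - E with E = exp(-(k+1)x). At a contact point Bernoulli gives gap^k ≥ 1 -
    -- kE, and g has slope at least 1, so the gap grows at rate at most kE, less than the slope
    -- (k+1)E of the barrier.
    have := image_le_of_deriv_right_lt_deriv_boundary (a := 0) (b := T)
      (f := fun x => f x - g x) (B := fun x => 1 - Real.exp (-(k + 1) * x))
      (B' := fun x => (k + 1) * Real.exp (-(k + 1) * x))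
      ((hfc.sub hgc).mono (Icc_subset_Icc_right hTb))
      (fun y hy => hzr y ⟨hy.1, hy.2.trans_le hTb⟩) (by simp [hf0, h.init])
      (fun y => by
        have := (((hasDerivAt_id y).const_mul (-((k : ℝ) + 1))).exp).const_sub 1
        refine this.congr_deriv ?_
        simp only [id]; ring) (fun y hy hyB => ?_) hx
    · have := Real.exp_pos (-(k + 1) * x)
      linarith
    · have hyb : y ∈ Icc 0 b := ⟨hy.1, hy.2.le.trans hTb⟩
      have hE := Real.exp_pos (-(k + 1) * y)
      have hmem : f y - g y ∈ Icc (0 : ℝ) 1 := ⟨hz0 y hyb, by rw [hyB]; linarith⟩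
      have hB : 1 + (k : ℝ) * (f y - g y - 1) ≤ (f y - g y) ^ k := by
        have := one_add_mul_le_pow (a := f y - g y - 1) (by linarith [hmem.1]) k
        simpa using this
      rw [clampUnit_of_mem hmem]
      have := hm1 y hy
      have e : f y - g y - 1 = - Real.exp (-(k + 1) * y) := by rw [hyB]; ring
      rw [e] at hB
      nlinarith
  obtain ⟨T', hT', hfT'⟩ : ∃ T' ∈ Icc 0 b, f T' = j + 1 := by
    refine intermediate_value_Icc hb0 hfc ⟨by rw [hf0]; positivity, ?_⟩
    have := hinc 0 b le_rfl hb0 le_rfl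
    linarith
  have hltT' : ∀ x ∈ Ico 0 T', f x < j + 1 := fun x hx => by
    have := hinc x T' hx.1 hx.2.le hT'.2
    linarith [hx.2]
  have hTT' : T < T' := by
    by_contra hle
    push Not at hle
    have h1 := hinc T' T hT'.1 hle (by linarith)
    have h2 := hz1 T ⟨hT0, le_rfl⟩
    rw [h.saturated T le_rfl] at h2
    linarith
  have hgap : ∀ x ∈ Ico 0 T', f x - g x < 1 := fun x hx => by
    rcases le_total x T with hxT | hxT
    · exact hz1 x ⟨hx.1, hxT⟩
    · rw [h.saturated x hxT]
      linarith [hltT' x hx]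
  set F : ℝ → ℝ := fun x => if x < T' then f x else j + 1 with hF
  have hFf : ∀ x, x ≤ T' → F x = f x := fun x hx => by
    rcases hx.lt_or_eq with hx | rfl
    · simp [hF, hx]
    · simp [hF, hfT']
  have hFs : ∀ x, T' ≤ x → F x = j + 1 := fun x hx => by simp [hF, not_lt.2 hx]
  have hmem : ∀ x ∈ Ico 0 T', f x - g x ∈ Icc (0 : ℝ) 1 := fun x hx =>
    ⟨hz0 x ⟨hx.1, hx.2.le.trans hT'.2⟩, (hgap x hx).le⟩
  have hFr : ∀ x ∈ Ico 0 T', HasDerivWithinAt F (2 - (F x - g x) ^ k) (Ici x) x := by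
    intro x hx
    have h1 := hfr x ⟨hx.1, hx.2.trans_le hT'.2⟩
    rw [clampUnit_of_mem (hmem x hx)] at h1
    rw [hFf x hx.2.le]
    refine h1.congr_of_eventuallyEq ?_ (hFf x hx.2.le)
    filter_upwards [mem_nhdsWithin_of_mem_nhds (Iio_mem_nhds hx.2)] with y hy
    exact hFf y (le_of_lt hy)
  have hslope : ∀ x ∈ Ico 0 T', (F x - g x) ^ k ∈ Icc (0 : ℝ) 1 := fun x hx => by
    rw [hFf x hx.2.le]; exact pow_mem_Icc (hmem x hx)
  refine ⟨T', F, hTT', ⟨hT'.1, ?_, ?_, fun x hx => ⟨_, ?_, hFr x hx⟩, fun x hx => ?_⟩,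
    ⟨hFr, fun x hx => ?_, fun x hx => ?_, fun x hx => ?_⟩⟩
  · have : ContinuousOn F (Icc 0 T' ∪ Ici T') := by
      refine ContinuousOn.union_of_isClosed ?_ ?_ isClosed_Icc isClosed_Ici
      · exact (hfc.mono (Icc_subset_Icc_right hT'.2)).congr fun x hx => hFf x hx.2
      · exact continuousOn_const.congr fun x hx => hFs x hx
    rwa [Icc_union_Ici_eq_Ici hT'.1] at this
  · rw [hFf 0 hT'.1, hf0]
  · have := hslope x hx
    exact ⟨by linarith [this.2], by linarith [this.1]⟩
  · rw [hFs x hx]; push_cast; ring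
  · have hxb : x < b := hx.2.trans_le hT'.2
    have h1 := (hf x ⟨hx.1.le, hxb.le⟩).hasDerivAt (Icc_mem_nhds hx.1 hxb)
    rw [clampUnit_of_mem (hmem x ⟨hx.1.le, hx.2⟩), ← hFf x hx.2.le] at h1
    refine h1.congr_of_eventuallyEq ?_
    filter_upwards [Iio_mem_nhds hx.2] with y hy
    exact hFf y (le_of_lt hy)
  · rcases le_total x T' with hxT | hxT
    · rw [hFf x hxT]; exact hz0 x ⟨hx, hxT.trans hT'.2⟩
    · rw [hFs x hxT, h.saturated x (hTT'.le.trans hxT)]; norm_num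
  · rw [hFf x hx.2.le]; exact hgap x hx

/-! ### The fluid limit -/

/-- The fluid limit `d j` of `∑ v, min (deg v) j / n` under the greedy strategy; it reaches its
maximum `j` at the time `X j`. -/
structure IsFluid (k : ℕ) (X : ℕ → ℝ) (d : ℕ → ℝ → ℝ) : Prop where
  time_zero : X 0 = 0
  zero : ∀ x, d 0 x = 0
  saturating : ∀ j, IsSaturating j (X j) (d j)
  time_lt : ∀ j, X j < X (j + 1)
  follows : ∀ j, Follows k (d j) (X (j + 1)) (d (j + 1))

theorem exists_isFluid {k : ℕ} (hk : 1 ≤ k) :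
    ∃ (X : ℕ → ℝ) (d : ℕ → ℝ → ℝ), IsFluid k X d := by
  choose! T f hT hs hf using fun (j : ℕ) (p : ℝ × (ℝ → ℝ)) (h : IsSaturating j p.1 p.2) =>
    h.exists_follows hk
  let s : ℕ → ℝ × (ℝ → ℝ) := fun j => Nat.rec (0, fun _ => 0) (fun j p => (T j p, f j p)) j
  have h0 : IsSaturating 0 (s 0).1 (s 0).2 :=
    ⟨le_rfl, continuousOn_const, rfl, fun x hx => absurd hx.2 (not_lt.2 hx.1), fun x _ => by
      simp [s]⟩
  have hsat : ∀ j, IsSaturating j (s j).1 (s j).2 := fun j => by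
    induction j with
    | zero => exact h0
    | succ j ih => exact hs j (s j) ih
  exact ⟨fun j => (s j).1, fun j => (s j).2, rfl, fun _ => rfl, hsat,
    fun j => hT j (s j) (hsat j), fun j => hf j (s j) (hsat j)⟩

namespace IsFluid

variable {k : ℕ} {X : ℕ → ℝ} {d : ℕ → ℝ → ℝ}

lemma time_strictMono (h : IsFluid k X d) : StrictMono X := strictMono_nat_of_lt_succ h.time_lt

lemma gap_mem (h : IsFluid k X d) (j : ℕ) {x : ℝ} (hx : 0 ≤ x) :
    d (j + 1) x - d j x ∈ Icc (0 : ℝ) 1 := by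
  refine ⟨(h.follows j).gap_nonneg x hx, ?_⟩
  rcases lt_or_ge x (X (j + 1)) with hlt | hge
  · exact ((h.follows j).gap_lt x ⟨hx, hlt⟩).le
  · rw [(h.saturating (j + 1)).saturated x hge,
      (h.saturating j).saturated x ((h.time_lt j).le.trans hge)]
    push_cast; linarith

/-- The fraction of vertices of degree at least `i` in the fluid limit. -/
def tail (d : ℕ → ℝ → ℝ) (i : ℕ) (x : ℝ) : ℝ := if i = 0 then 1 else d i x - d (i - 1) x

lemma tail_succ (i : ℕ) (x : ℝ) : tail d (i + 1) x = d (i + 1) x - d i x := by simp [tail]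

lemma sum_tail_sub {q i : ℕ} (hqi : q ≤ i) (x : ℝ) :
    ∑ a ∈ Finset.Ico q i, (tail d a x - tail d (a + 1) x) = tail d q x - tail d i x := by
  induction i, hqi using Nat.le_induction with
  | base => simp
  | succ i hi ih => rw [Finset.sum_Ico_succ_top hi, ih]; ring

lemma tail_eq_one (h : IsFluid k X d) {q : ℕ} {x : ℝ} (hx : X q ≤ x) : tail d q x = 1 := by
  cases q with
  | zero => simp [tail]
  | succ q =>
    rw [tail_succ, (h.saturating _).saturated x hx,
      (h.saturating q).saturated x ((h.time_lt q).le.trans hx)]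
    push_cast; ring

lemma continuousOn_tail (h : IsFluid k X d) (i : ℕ) : ContinuousOn (tail d i) (Ici 0) := by
  cases i with
  | zero => exact (continuousOn_const (c := (1 : ℝ))).congr fun x _ => by simp [tail]
  | succ i =>
    exact ((h.saturating (i + 1)).cont.sub (h.saturating i).cont).congr fun x _ => tail_succ i x

lemma hasDerivAt_tail (h : IsFluid k X d) {q : ℕ} {x : ℝ} (hx : x ∈ Ioo (X q) (X (q + 1))) :
    HasDerivAt (tail d q) 0 x :=
  (hasDerivAt_const x (1 : ℝ)).congr_of_eventuallyEq <| by
    filter_upwards [Ioi_mem_nhds hx.1] with y hy using h.tail_eq_one (le_of_lt hy)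

/-- In phase `q` the function `d q` is frozen at `q`, so for `i = q` the constant 2 survives; for `i
> q` the constants of `d (i + 1)` and `d i` cancel. -/
lemma hasDerivAt_tail_succ (h : IsFluid k X d) {q i : ℕ} (hqi : q ≤ i) {x : ℝ}
    (hx : x ∈ Ioo (X q) (X (q + 1))) :
    HasDerivAt (tail d (i + 1))
      ((if i = q then 2 else tail d i x ^ k) - tail d (i + 1) x ^ k) x := by
  have hX := h.time_strictMono
  have hx0 : 0 < x := (h.saturating q).nonneg.trans_lt hx.1
  have hd : ∀ j, q ≤ j → HasDerivAt (d (j + 1)) (2 - tail d (j + 1) x ^ k) x := fun j hj => by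
    rw [tail_succ]
    exact (h.follows j).deriv x ⟨hx0, hx.2.trans_le (hX.monotone (by omega))⟩
  have e : tail d (i + 1) = fun x => d (i + 1) x - d i x := funext fun x => tail_succ i x
  rw [e]
  by_cases hiq : i = q
  · subst hiq
    have h0 : HasDerivAt (d i) 0 x := (hasDerivAt_const x (i : ℝ)).congr_of_eventuallyEq <| by
      filter_upwards [Ioi_mem_nhds hx.1] with y hy using (h.saturating i).saturated y (le_of_lt hy)
    refine ((hd i le_rfl).sub h0).congr_deriv ?_
    simp [tail_succ]
  · obtain ⟨i, rfl⟩ : ∃ m, i = m + 1 := ⟨i - 1, by omega⟩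
    refine ((hd (i + 1) hqi).sub (hd i (by omega))).congr_deriv ?_
    simp only [tail_succ, hiq, if_false]
    ring

lemma phaseRHS_tail (h : IsFluid k X d) {q i : ℕ} (hqi : q ≤ i) {x : ℝ} (hx : X q ≤ x) :
    phaseRHS k q i (fun a => tail d a x - tail d (a + 1) x) =
      -(if i = q then 1 else 0) + (if i = q + 1 then 1 else 0)
        - (tail d i x ^ k - tail d (i + 1) x ^ k)
        + (if q + 1 ≤ i then tail d (i - 1) x ^ k - tail d i x ^ k else 0) := by
  have h1 := h.tail_eq_one hx
  have hI : Finset.Icc q i = Finset.Ico q (i + 1) := rfl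
  unfold phaseRHS
  rw [hI, sum_tail_sub hqi, sum_tail_sub (hqi.trans i.le_succ), h1]
  split_ifs with h2 h3 h4
  any_goals omega
  all_goals try rw [sum_tail_sub (by omega), h1]
  all_goals ring

/-- The fraction of vertices of degree exactly `i` is the difference of two consecutive tails. In
phase `q` the tail at `q` is 1, so the partial sums in the phase equation telescope: each `1 - ∑
y_a` is again a tail. The function `y_q` vanishes when the tail at `q + 1` becomes 1, which happens
first at `X (q + 1)`. -/
theorem isPhaseSolution (h : IsFluid k X d) (ℓ : ℕ) :
    IsPhaseSolution k ℓ X fun i x => tail d i x - tail d (i + 1) x where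
  start := h.time_zero
  init i _ := by
    have h0 : ∀ j, d j 0 = 0 := fun j => (h.saturating j).init
    by_cases hi : i = 0 <;> simp [tail, h0, hi]
  lt q _ := h.time_lt q
  cont q _ i _ _ := ((h.continuousOn_tail i).sub (h.continuousOn_tail (i + 1))).mono
    fun _ hx => (h.saturating q).nonneg.trans hx.1
  ode q _ i hqi _ x hx := by
    rw [h.phaseRHS_tail hqi hx.1.le]
    by_cases hiq : i = q
    · subst hiq
      refine ((h.hasDerivAt_tail hx).sub (h.hasDerivAt_tail_succ le_rfl hx)).congr_deriv ?_
      simp [h.tail_eq_one hx.1.le]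
      ring
    · obtain ⟨i, rfl⟩ : ∃ m, i = m + 1 := ⟨i - 1, by omega⟩
      refine ((h.hasDerivAt_tail_succ (by omega) hx).sub
        (h.hasDerivAt_tail_succ hqi hx)).congr_deriv ?_
      have h1 := h.tail_eq_one hx.1.le
      by_cases hi : i = q
      · subst hi
        simp [h1]
        ring
      · have hq : q ≤ i := by omega
        simp [hi, hiq, hq]
        ring
  pos q _ x hx := by
    have hx0 : 0 ≤ x := (h.saturating q).nonneg.trans hx.1
    have := (h.follows q).gap_lt x ⟨hx0, hx.2⟩
    simp only [h.tail_eq_one hx.1, tail_succ]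
    linarith
  zero q _ := by
    simp only [h.tail_eq_one (h.time_lt q).le, h.tail_eq_one le_rfl, sub_self]

end IsFluid

/-! ### Uniqueness of phase solutions -/

lemma phaseRHS_congr {k q i : ℕ} {y y' : ℕ → ℝ} (h : ∀ a, q ≤ a → a ≤ i → y a = y' a) :
    phaseRHS k q i y = phaseRHS k q i y' := by
  have hs : ∀ s : Finset ℕ, s ⊆ Finset.Icc q i → ∑ a ∈ s, y a = ∑ a ∈ s, y' a := fun s hs =>
    Finset.sum_congr rfl fun a ha => by
      have := Finset.mem_Icc.1 (hs ha)
      exact h a this.1 this.2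
  unfold phaseRHS
  rw [hs (Finset.Ico q i) Finset.Ico_subset_Icc_self, hs (Finset.Icc q i) subset_rfl,
    hs (Finset.Ico q (i - 1)) fun a ha => by
      simp only [Finset.mem_Ico, Finset.mem_Icc] at ha ⊢; omega]

/-- The vector field of phase `q`, on the coordinates `i` with `q ≤ i < ℓ`. -/
def phaseField (k ℓ q : ℕ) (y : Fin ℓ → ℝ) (i : Fin ℓ) : ℝ :=
  if q ≤ (i : ℕ) then phaseRHS k q i fun a => if h : a < ℓ then y ⟨a, h⟩ else 0 else 0

lemma contDiff_phaseField (k ℓ q : ℕ) : ContDiff ℝ 1 (phaseField k ℓ q) := by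
  refine contDiff_pi.2 fun i => ?_
  unfold phaseField
  split_ifs with hq
  · have hs : ∀ s : Finset ℕ, ContDiff ℝ 1 fun y : Fin ℓ → ℝ =>
        ∑ a ∈ s, if h : a < ℓ then y ⟨a, h⟩ else 0 := fun s =>
      ContDiff.sum fun a _ => by
        split_ifs
        · exact contDiff_apply ℝ ℝ _
        · exact contDiff_const
    have hp : ∀ s : Finset ℕ, ContDiff ℝ 1 fun y : Fin ℓ → ℝ =>
        (1 - ∑ a ∈ s, if h : a < ℓ then y ⟨a, h⟩ else 0) ^ k := fun s =>
      (contDiff_const.sub (hs s)).pow k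
    unfold phaseRHS
    refine ContDiff.add (contDiff_const.sub ((hp _).sub (hp _))) ?_
    split_ifs
    · exact (hp _).sub (hp _)
    · exact contDiff_const
  · exact contDiff_const

/-- The functions of phase `q` as a curve in the phase space. -/
def phaseCurve (ℓ q : ℕ) (y : ℕ → ℝ → ℝ) (x : ℝ) (i : Fin ℓ) : ℝ :=
  if q ≤ (i : ℕ) then y i x else 0

lemma continuousOn_phaseCurve {ℓ q : ℕ} {y : ℕ → ℝ → ℝ} {s : Set ℝ}
    (hc : ∀ i, q ≤ i → i < ℓ → ContinuousOn (y i) s) : ContinuousOn (phaseCurve ℓ q y) s := by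
  refine continuousOn_pi.2 fun i => ?_
  unfold phaseCurve
  split_ifs with h
  · exact hc i h i.2
  · exact continuousOn_const

lemma hasDerivAt_phaseCurve {k ℓ q : ℕ} {y : ℕ → ℝ → ℝ} {x : ℝ}
    (hd : ∀ i, q ≤ i → i < ℓ → HasDerivAt (y i) (phaseRHS k q i fun a => y a x) x) :
    HasDerivAt (phaseCurve ℓ q y) (phaseField k ℓ q (phaseCurve ℓ q y x)) x := by
  refine hasDerivAt_pi.2 fun i => ?_
  unfold phaseCurve phaseField
  by_cases h : q ≤ (i : ℕ)
  · simp only [h, if_true]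
    refine (hd i h i.2).congr_deriv (phaseRHS_congr fun a ha hai => ?_)
    simp [ha, hai.trans_lt i.2]
  · simp only [h, if_false]
    exact hasDerivAt_const x _

/-- The equations are only assumed in the open interval. At the left endpoint the right derivative
exists as the limit of the derivatives, by continuity of the curve and of the field. -/
lemma right_hasDeriv_phaseCurve {k ℓ q : ℕ} {y : ℕ → ℝ → ℝ} {a b : ℝ}
    (hc : ∀ i, q ≤ i → i < ℓ → ContinuousOn (y i) (Icc a b))
    (hd : ∀ i, q ≤ i → i < ℓ → ∀ x ∈ Ioo a b,
      HasDerivAt (y i) (phaseRHS k q i fun a => y a x) x) {x : ℝ} (hx : x ∈ Ico a b) :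
    HasDerivWithinAt (phaseCurve ℓ q y) (phaseField k ℓ q (phaseCurve ℓ q y x)) (Ici x) x := by
  have hC := continuousOn_phaseCurve hc
  have hD : ∀ z ∈ Ioo a b, HasDerivAt (phaseCurve ℓ q y)
      (phaseField k ℓ q (phaseCurve ℓ q y z)) z := fun z hz =>
    hasDerivAt_phaseCurve fun i h1 h2 => hd i h1 h2 z hz
  have hsub : Ioo x b ⊆ Ioo a b := Ioo_subset_Ioo_left hx.1
  have hmem : Ioo x b ∈ 𝓝[>] x := Ioo_mem_nhdsGT hx.2
  have hxC : ContinuousWithinAt (phaseCurve ℓ q y) (Ioo x b) x :=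
    (hC x ⟨hx.1, hx.2.le⟩).mono (hsub.trans Ioo_subset_Icc_self)
  refine hasDerivWithinAt_Ici_of_tendsto_deriv
    (fun z hz => (hD z (hsub hz)).differentiableAt.differentiableWithinAt) hxC hmem ?_
  have h1 : Tendsto (fun z => phaseField k ℓ q (phaseCurve ℓ q y z)) (𝓝[>] x)
      (𝓝 (phaseField k ℓ q (phaseCurve ℓ q y x))) := by
    refine ((contDiff_phaseField k ℓ q).continuous.tendsto _).comp (hxC.mono_left ?_)
    exact nhdsWithin_le_of_mem hmem
  refine h1.congr' ?_
  filter_upwards [hmem] with z hz using (hD z (hsub hz)).deriv.symm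

/-- The field is polynomial, hence Lipschitz on a ball containing the compact images of both curves,
and Grönwall uniqueness applies there. -/
lemma phase_eqOn {k ℓ q : ℕ} {y y' : ℕ → ℝ → ℝ} {a b : ℝ}
    (hc : ∀ i, q ≤ i → i < ℓ → ContinuousOn (y i) (Icc a b))
    (hd : ∀ i, q ≤ i → i < ℓ → ∀ x ∈ Ioo a b,
      HasDerivAt (y i) (phaseRHS k q i fun a => y a x) x)
    (hc' : ∀ i, q ≤ i → i < ℓ → ContinuousOn (y' i) (Icc a b))
    (hd' : ∀ i, q ≤ i → i < ℓ → ∀ x ∈ Ioo a b,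
      HasDerivAt (y' i) (phaseRHS k q i fun a => y' a x) x)
    (h0 : ∀ i, q ≤ i → i < ℓ → y i a = y' i a) {i : ℕ} (hqi : q ≤ i) (hi : i < ℓ) :
    EqOn (y i) (y' i) (Icc a b) := by
  have hC := continuousOn_phaseCurve hc
  have hC' := continuousOn_phaseCurve hc'
  have hcomp := (isCompact_Icc.image_of_continuousOn hC).union
    (isCompact_Icc.image_of_continuousOn hC')
  obtain ⟨R, hR⟩ := hcomp.isBounded.subset_closedBall 0
  obtain ⟨K, hK⟩ := ((contDiff_phaseField k ℓ q).locallyLipschitz.locallyLipschitzOn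
    (s := Metric.closedBall 0 R)).exists_lipschitzOnWith_of_compact (isCompact_closedBall 0 R)
  have hE := ODE_solution_unique_of_mem_Icc_right (v := fun _ => phaseField k ℓ q)
    (s := fun _ => Metric.closedBall 0 R) (fun _ _ => hK) hC
    (fun x hx => right_hasDeriv_phaseCurve hc hd hx)
    (fun x hx => hR (Or.inl (mem_image_of_mem _ (Ico_subset_Icc_self hx)))) hC'
    (fun x hx => right_hasDeriv_phaseCurve hc' hd' hx)
    (fun x hx => hR (Or.inr (mem_image_of_mem _ (Ico_subset_Icc_self hx))))
    (funext fun i => by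
      unfold phaseCurve
      split_ifs with h
      · exact h0 i h i.2
      · rfl)
  intro x hx
  have := congrFun (hE hx) ⟨i, hi⟩
  simpa [phaseCurve, hqi] using this

theorem IsPhaseSolution.time_eq {k ℓ : ℕ} {X X' : ℕ → ℝ} {y y' : ℕ → ℝ → ℝ}
    (h : IsPhaseSolution k ℓ X y) (h' : IsPhaseSolution k ℓ X' y') : ∀ q ≤ ℓ, X q = X' q := by
  suffices H : ∀ q ≤ ℓ, X q = X' q ∧ ∀ i, q ≤ i → i < ℓ → y i (X q) = y' i (X q) from
    fun q hq => (H q hq).1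
  intro q
  induction q with
  | zero =>
    refine fun _ => ⟨h.start.trans h'.start.symm, fun i _ hi => ?_⟩
    rw [h.start, h.init i hi, h'.init i hi]
  | succ q ih =>
    intro hq
    obtain ⟨hX, h0⟩ := ih (by omega)
    have hlt := h.lt q hq
    have hlt' := h'.lt q hq
    rw [← hX] at hlt'
    -- Up to the earlier of the two end times both solutions are defined and agree. There one of the
    -- functions `y q`, `y' q` vanishes, hence so does the other, and positivity within the phase
    -- makes the end times equal.
    set b := min (X (q + 1)) (X' (q + 1))
    have hb : b ∈ Icc (X q) b := ⟨le_min hlt.le hlt'.le, le_rfl⟩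
    have hE : ∀ i, q ≤ i → i < ℓ → y i b = y' i b := fun i hqi hi =>
      phase_eqOn (a := X q) (b := b) (k := k) (ℓ := ℓ)
        (fun i h1 h2 => (h.cont q hq i h1 h2).mono (Icc_subset_Icc_right (min_le_left _ _)))
        (fun i h1 h2 x hx => h.ode q hq i h1 h2 x ⟨hx.1, hx.2.trans_le (min_le_left _ _)⟩)
        (fun i h1 h2 => (h'.cont q hq i h1 h2).mono
          (by rw [hX]; exact Icc_subset_Icc_right (min_le_right _ _)))
        (fun i h1 h2 x hx => h'.ode q hq i h1 h2 x
          ⟨hX ▸ hx.1, hx.2.trans_le (min_le_right _ _)⟩) h0 hqi hi hb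
    have hXX : X (q + 1) = X' (q + 1) := by
      rcases lt_trichotomy (X (q + 1)) (X' (q + 1)) with hl | hl | hl
      · have e : b = X (q + 1) := min_eq_left hl.le
        have := h'.pos q hq b ⟨hX ▸ hb.1, e ▸ hl⟩
        rw [← hE q le_rfl hq, e, h.zero q hq] at this
        exact absurd this (lt_irrefl _)
      · exact hl
      · have e : b = X' (q + 1) := min_eq_right hl.le
        have := h.pos q hq b ⟨hb.1, e ▸ hl⟩
        rw [hE q le_rfl hq, e, h'.zero q hq] at this
        exact absurd this (lt_irrefl _)
    refine ⟨hXX, fun i hqi hi => ?_⟩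
    have e : b = X (q + 1) := by rw [← min_self (X (q + 1))]; simp only [b, hXX]
    rw [← e]
    exact hE i (by omega) hi

theorem IsFluid.isFinalTime_iff {k : ℕ} {X : ℕ → ℝ} {d : ℕ → ℝ → ℝ} (h : IsFluid k X d) (ℓ : ℕ)
    (x : ℝ) : IsFinalTime k ℓ x ↔ x = X ℓ := by
  constructor
  · rintro ⟨X', y', h', rfl⟩
    exact h'.time_eq (h.isPhaseSolution ℓ) ℓ le_rfl
  · rintro rfl
    exact ⟨X, _, h.isPhaseSolution ℓ, rfl⟩

/-! ### Increments of the fluid limit -/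

namespace IsFluid

variable {k : ℕ} {X : ℕ → ℝ} {d : ℕ → ℝ → ℝ}

lemma abs_gap_sub_le (h : IsFluid k X d) (j : ℕ) {x y : ℝ} (hx : 0 ≤ x) (hxy : x ≤ y) :
    |(d (j + 1) y - d j y) - (d (j + 1) x - d j x)| ≤ 2 * (y - x) := by
  have h1 := (h.saturating (j + 1)).monotone_sub hx hxy
  have h2 := (h.saturating j).monotone_sub hx hxy
  rw [abs_le]
  constructor <;> linarith [h1.1, h1.2, h2.1, h2.2]

lemma abs_gap_pow_sub_le (h : IsFluid k X d) (j : ℕ) {x y ε : ℝ} (hx : 0 ≤ x) (hxy : x ≤ y)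
    (hy : y - x ≤ ε) :
    |(d (j + 1) y - d j y) ^ k - (d (j + 1) x - d j x) ^ k| ≤ 2 * k * ε :=
  calc _ ≤ k * |(d (j + 1) y - d j y) - (d (j + 1) x - d j x)| :=
        abs_pow_sub_pow_le_of_mem_Icc (h.gap_mem j (hx.trans hxy)) (h.gap_mem j hx)
    _ ≤ k * (2 * (y - x)) :=
        mul_le_mul_of_nonneg_left (h.abs_gap_sub_le j hx hxy) (Nat.cast_nonneg k)
    _ ≤ k * (2 * ε) := by gcongr
    _ = _ := by ring

/-- After saturation the derivative is 0, which is below `2 - gap ^ k` because the gap is at most 1.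
In this direction the differential inequality thus holds at all times, whereas the reverse one
requires times before `X (j + 1)`. -/
lemma exists_right_deriv_le (h : IsFluid k X d) (j : ℕ) :
    ∃ m : ℝ → ℝ, ∀ x, 0 ≤ x → HasDerivWithinAt (d (j + 1)) (m x) (Ici x) x ∧
      m x ≤ 2 - (d (j + 1) x - d j x) ^ k := by
  have hs := h.saturating (j + 1)
  obtain ⟨m, hm, -, -⟩ := hs.right_deriv
  refine ⟨m, fun y hy => ⟨hm y hy, ?_⟩⟩
  rcases lt_or_ge y (X (j + 1)) with hlt | hge
  · exact ((uniqueDiffWithinAt_Ici y).eq_deriv _ (hm y hy)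
      ((h.follows j).right_deriv y ⟨hy, hlt⟩)).le
  · have e := (uniqueDiffWithinAt_Ici y).eq_deriv _ (hm y hy)
      ((hasDerivWithinAt_const y (Ici y) ((j + 1 : ℕ) : ℝ)).congr
        (fun z hz => hs.saturated z (hge.trans hz)) (hs.saturated y hge))
    rw [e]
    linarith [(pow_mem_Icc (k := k) (h.gap_mem j hy)).2]

/-- One Euler step: the gap is 2-Lipschitz in time, so its `k`-th power moves by at most `2 * k * ε`
during the step. -/
lemma sub_le_step (h : IsFluid k X d) (j : ℕ) {x ε : ℝ} (hx : 0 ≤ x) (hε : 0 ≤ ε) :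
    d (j + 1) (x + ε) - d (j + 1) x ≤
      ε * (2 - (d (j + 1) x - d j x) ^ k) + 2 * k * ε ^ 2 := by
  obtain ⟨m, hm⟩ := h.exists_right_deriv_le j
  have := sub_le_of_right_deriv_le (C := 2 - (d (j + 1) x - d j x) ^ k + 2 * k * ε)
    (by linarith : x ≤ x + ε) ((h.saturating (j + 1)).cont.mono fun z hz => hx.trans hz.1)
    (fun y hy => (hm y (hx.trans hy.1)).1) (fun y hy => by
      have h1 := (hm y (hx.trans hy.1)).2
      have := (abs_le.1 (h.abs_gap_pow_sub_le j hx hy.1 (ε := ε) (by linarith [hy.2]))).1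
      linarith)
  calc _ ≤ _ := this
    _ = _ := by ring

lemma le_sub_step (h : IsFluid k X d) (j : ℕ) {x ε : ℝ} (hx : 0 ≤ x) (hε : 0 ≤ ε)
    (hX : x + ε ≤ X (j + 1)) :
    ε * (2 - (d (j + 1) x - d j x) ^ k) - 2 * k * ε ^ 2 ≤ d (j + 1) (x + ε) - d (j + 1) x := by
  have := le_sub_of_le_right_deriv (C := 2 - (d (j + 1) x - d j x) ^ k - 2 * k * ε)
    (by linarith : x ≤ x + ε) ((h.saturating (j + 1)).cont.mono fun z hz => hx.trans hz.1)
    (fun y hy => (h.follows j).right_deriv y ⟨hx.trans hy.1, hy.2.trans_le hX⟩)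
    (fun y hy => by
      have := (abs_le.1 (h.abs_gap_pow_sub_le j hx hy.1 (ε := ε) (by linarith [hy.2]))).2
      linarith)
  calc _ = _ := by ring
    _ ≤ _ := this

end IsFluid

/-! ### Means over finite probability spaces -/

/-- The mean of `f` under `μ`. -/
def mean {α : Type*} [Fintype α] (μ : PMF α) (f : α → ℝ) : ℝ := ∑ a, (μ a).toReal * f a

section Mean

variable {α β : Type*} [Fintype α] [Fintype β] (μ : PMF α) {f g : α → ℝ}

lemma sum_toReal_eq_one : ∑ a, (μ a).toReal = 1 := by
  have h := μ.tsum_coe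
  rw [tsum_fintype] at h
  rw [← ENNReal.toReal_sum fun a _ => μ.apply_ne_top a, h, ENNReal.toReal_one]

lemma mean_mono (h : ∀ a, f a ≤ g a) : mean μ f ≤ mean μ g :=
  Finset.sum_le_sum fun a _ => mul_le_mul_of_nonneg_left (h a) ENNReal.toReal_nonneg

lemma mean_const (c : ℝ) : mean μ (fun _ => c) = c := by
  rw [mean, ← Finset.sum_mul, sum_toReal_eq_one, one_mul]

lemma mean_add (f g : α → ℝ) : mean μ (fun a => f a + g a) = mean μ f + mean μ g := by
  simp only [mean, mul_add, Finset.sum_add_distrib]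

lemma mean_const_mul (c : ℝ) (f : α → ℝ) : mean μ (fun a => c * f a) = c * mean μ f := by
  simp only [mean, Finset.mul_sum]
  exact Finset.sum_congr rfl fun a _ => by ring

lemma mean_sub (f g : α → ℝ) : mean μ (fun a => f a - g a) = mean μ f - mean μ g := by
  simp only [mean, mul_sub, Finset.sum_sub_distrib]

lemma mean_nonneg (h : ∀ a, 0 ≤ f a) : 0 ≤ mean μ f :=
  (mean_const μ 0).symm.le.trans (mean_mono μ h)

lemma pow_mean_le (h : ∀ a, 0 ≤ f a) (k : ℕ) : mean μ f ^ k ≤ mean μ fun a => f a ^ k :=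
  Real.pow_arith_mean_le_arith_mean_pow _ _ _ (fun _ _ => ENNReal.toReal_nonneg)
    (sum_toReal_eq_one μ) (fun a _ => h a) k

lemma mean_pure (a : α) (f : α → ℝ) : mean (PMF.pure a) f = f a := by
  classical
  rw [mean, Finset.sum_eq_single a]
  · simp
  · intro b _ hb; simp [hb]
  · simp

lemma mean_bind (F : α → PMF β) (g : β → ℝ) :
    mean (μ.bind F) g = mean μ fun a => mean (F a) g := by
  simp only [mean, PMF.bind_apply, tsum_fintype]
  have : ∀ b, (∑ a, μ a * F a b).toReal = ∑ a, (μ a).toReal * (F a b).toReal := fun b => by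
    rw [ENNReal.toReal_sum fun a _ => ENNReal.mul_ne_top (μ.apply_ne_top a) ((F a).apply_ne_top b)]
    simp only [ENNReal.toReal_mul]
  simp only [this, Finset.sum_mul, Finset.mul_sum]
  rw [Finset.sum_comm]
  exact Finset.sum_congr rfl fun a _ => Finset.sum_congr rfl fun b _ => by ring

lemma mean_map (F : α → β) (g : β → ℝ) : mean (μ.map F) g = mean μ fun a => g (F a) := by
  rw [← PMF.bind_pure_comp, mean_bind]
  simp only [Function.comp, mean_pure]

open Classical in
lemma toOuterMeasure_eq_ofReal_mean (s : Set α) :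
    μ.toOuterMeasure s = ENNReal.ofReal (mean μ fun a => if a ∈ s then 1 else 0) := by
  rw [PMF.toOuterMeasure_apply_fintype, mean,
    ENNReal.ofReal_sum_of_nonneg fun a _ => by positivity]
  refine Finset.sum_congr rfl fun a _ => ?_
  by_cases h : a ∈ s <;> simp [h, μ.apply_ne_top a]

open Classical in
lemma mean_uniform_forall_mem {n k : ℕ} [NeZero n] (A : Finset (Fin n)) :
    mean (PMF.uniformOfFintype (Fin k → Fin n)) (fun w => if ∀ i, w i ∈ A then 1 else 0) =
      ((A.card : ℝ) / n) ^ k := by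
  simp only [mean, PMF.uniformOfFintype_apply, ENNReal.toReal_inv, ENNReal.toReal_natCast,
    mul_ite, mul_one, mul_zero]
  rw [← Finset.sum_filter, Finset.sum_const]
  have : (Finset.univ.filter fun w : Fin k → Fin n => ∀ i, w i ∈ A) =
      Fintype.piFinset fun _ => A := by
    ext w; simp
  rw [this, Fintype.card_piFinset]
  simp [div_eq_mul_inv, mul_pow]

end Mean

/-! ### Truncated degree sums -/

section Degree

variable {n t : ℕ}

lemma degree_graph (h : History n t) (x : Fin n) :
    degree h.graph x = ∑ s, ((if (h s).1 = x then 1 else 0) + if (h s).2 = x then 1 else 0) := by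
  unfold degree History.graph
  rw [Multiset.map_map]
  refine Finset.sum_congr rfl fun s _ => ?_
  simp only [Function.comp, Sym2.toMultiset, Sym2.lift_mk]
  simp only [Multiset.coe_count, List.count_cons, List.count_nil, beq_iff_eq]
  omega

lemma degree_snoc (h : History n t) (u v x : Fin n) :
    degree (History.graph (Fin.snoc h (u, v) : History n (t + 1))) x =
      degree h.graph x + ((if u = x then 1 else 0) + if v = x then 1 else 0) := by
  rw [degree_graph, degree_graph, Fin.sum_univ_castSucc]
  simp

/-- The sum over all vertices of the degrees truncated at `j`. -/
def total (j : ℕ) (h : History n t) : ℕ := ∑ x, min (degree h.graph x) j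

lemma total_le (j : ℕ) (h : History n t) : total j h ≤ n * j := by
  refine (Finset.sum_le_card_nsmul _ _ j fun x _ => min_le_right _ _).trans (by simp)

lemma total_eq_iff (j : ℕ) (h : History n t) :
    n * j ≤ total j h ↔ MinDegreeAtLeast j n h.graph := by
  constructor
  · intro hle x
    by_contra hx
    have : total j h < ∑ _x : Fin n, j :=
      Finset.sum_lt_sum (fun x _ => min_le_right _ _) ⟨x, Finset.mem_univ x, by
        rw [min_lt_iff]; exact Or.inl (not_le.1 hx)⟩
    simp at this
    omega
  · intro hm
    have : total j h = ∑ _x : Fin n, j := Finset.sum_congr rfl fun x _ => min_eq_right (hm x)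
    simp [this]

lemma total_succ (j : ℕ) (h : History n t) :
    total (j + 1) h =
      total j h + (Finset.univ.filter fun x => j + 1 ≤ degree h.graph x).card := by
  rw [Finset.card_filter, total, total, ← Finset.sum_add_distrib]
  refine Finset.sum_congr rfl fun x _ => ?_
  split_ifs <;> omega

lemma total_snoc_le (j : ℕ) (h : History n t) (u v : Fin n) :
    total j (Fin.snoc h (u, v) : History n (t + 1)) ≤
      total j h + 1 + if degree h.graph u < j then 1 else 0 := by
  have : total j (Fin.snoc h (u, v) : History n (t + 1)) ≤ ∑ x, (min (degree h.graph x) j +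
      (if v = x then 1 else 0) +
      if u = x then (if degree h.graph x < j then 1 else 0) else 0) := by
    refine Finset.sum_le_sum fun x _ => ?_
    rw [degree_snoc]
    split_ifs <;> omega
  simpa [Finset.sum_add_distrib, total] using this

lemma total_le_total_snoc (j : ℕ) (h : History n t) (u v : Fin n) :
    total j h ≤ total j (Fin.snoc h (u, v) : History n (t + 1)) :=
  Finset.sum_le_sum fun x _ => by rw [degree_snoc]; omega

/-- A circle below the threshold always counts, and so does a square below it. The correction for `u
= v` is needed because a loop at a vertex of degree `j - 1` gains only one unit. -/
lemma le_total_snoc (j : ℕ) (h : History n t) (u v : Fin n) (hv : degree h.graph v < j) :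
    total j h + 1 + (if degree h.graph u < j then 1 else 0) ≤
      total j (Fin.snoc h (u, v) : History n (t + 1)) + if u = v then 1 else 0 := by
  by_cases huv : u = v
  · subst huv
    have : ∑ x, (min (degree h.graph x) j + if u = x then 1 else 0) ≤
        total j (Fin.snoc h (u, u) : History n (t + 1)) := by
      refine Finset.sum_le_sum fun x _ => ?_
      rw [degree_snoc]
      split_ifs with h1
      · subst h1; omega
      · omega
    simp [Finset.sum_add_distrib] at this
    rw [show ∑ x, min (degree h.graph x) j = total j h from rfl] at this
    simp [hv]; omega
  · have : ∑ x, (min (degree h.graph x) j + (if v = x then 1 else 0) +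
        if u = x then (if degree h.graph x < j then 1 else 0) else 0) ≤
        total j (Fin.snoc h (u, v) : History n (t + 1)) := by
      refine Finset.sum_le_sum fun x _ => ?_
      rw [degree_snoc]
      by_cases h1 : v = x
      · subst h1
        simp [huv]; omega
      · simp only [h1, if_false]
        split_ifs <;> omega
    simpa [Finset.sum_add_distrib, total, huv] using this

/-- The truncated degree sum, divided by the number of vertices. -/
def level (j : ℕ) (h : History n t) : ℝ := (total j h : ℝ) / n

lemma level_zero (h : History n t) : level 0 h = 0 := by simp [level, total]

lemma level_le [NeZero n] (j : ℕ) (h : History n t) : level j h ≤ j := by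
  have hn : (0 : ℝ) < n := by exact_mod_cast NeZero.pos n
  rw [level, div_le_iff₀ hn, mul_comm]
  exact_mod_cast total_le j h

lemma level_nonneg (j : ℕ) (h : History n t) : 0 ≤ level j h := by unfold level; positivity

lemma level_gap (j : ℕ) (h : History n t) : level (j + 1) h - level j h =
    ((Finset.univ.filter fun x => j + 1 ≤ degree h.graph x).card : ℝ) / n := by
  rw [level, level, total_succ]; push_cast; ring

lemma level_gap_mem [NeZero n] (j : ℕ) (h : History n t) :
    level (j + 1) h - level j h ∈ Icc (0 : ℝ) 1 := by
  have hn : (0 : ℝ) < n := by exact_mod_cast NeZero.pos n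
  rw [level_gap]
  refine ⟨by positivity, ?_⟩
  rw [div_le_one hn]
  have := Finset.card_le_univ (Finset.univ.filter fun x => j + 1 ≤ degree h.graph x)
  simp only [Fintype.card_fin] at this
  exact_mod_cast this

lemma level_snoc_sub_mem [NeZero n] (j : ℕ) (h : History n t) (u v : Fin n) :
    level j (Fin.snoc h (u, v) : History n (t + 1)) - level j h ∈ Icc (0 : ℝ) (2 * (1 / n)) := by
  have hn : (0 : ℝ) < n := by exact_mod_cast NeZero.pos n
  have h1 : (total j h : ℝ) ≤ total j (Fin.snoc h (u, v) : History n (t + 1)) := by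
    exact_mod_cast total_le_total_snoc j h u v
  have h2 : (total j (Fin.snoc h (u, v) : History n (t + 1)) : ℝ) ≤ total j h + 2 := by
    have := total_snoc_le j h u v
    have h3 : total j (Fin.snoc h (u, v) : History n (t + 1)) ≤ total j h + 2 := by
      split_ifs at this <;> omega
    exact_mod_cast h3
  rw [level, level, ← sub_div]
  refine ⟨div_nonneg (by linarith) hn.le, ?_⟩
  rw [mul_one_div]
  gcongr
  linarith

end Degree

/-! ### One round of the process -/

section Round

variable {k n : ℕ} [NeZero n]

/-- The probability that the minimum degree after `t` rounds is at least `ℓ`. -/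
def successProb (S : Strategy k n) (ℓ t : ℕ) : ℝ :=
  mean (historyLaw S t) fun h => if n * ℓ ≤ total ℓ h then 1 else 0

lemma graphLaw_minDegree (S : Strategy k n) (ℓ t : ℕ) :
    (graphLaw S t).toOuterMeasure {G | MinDegreeAtLeast ℓ n G} =
      ENNReal.ofReal (successProb S ℓ t) := by
  classical
  rw [graphLaw, PMF.toOuterMeasure_map_apply, toOuterMeasure_eq_ofReal_mean, successProb]
  simp only [mem_preimage, mem_ofPred_eq, ← total_eq_iff]

lemma mean_historyLaw_succ (S : Strategy k n) (t : ℕ) (f : History n (t + 1) → ℝ) :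
    mean (historyLaw S (t + 1)) f = mean (historyLaw S t) fun h =>
      mean (PMF.uniformOfFintype (Fin k → Fin n)) fun w =>
        mean (S t h w) fun p => f (Fin.snoc h (w p.1, p.2)) := by
  rw [historyLaw, mean_bind]
  simp only [mean_bind, mean_map]

lemma mean_forall_le_degree {t : ℕ} (h : History n t) (j : ℕ) :
    mean (PMF.uniformOfFintype (Fin k → Fin n))
      (fun w => if ∀ i, j + 1 ≤ degree h.graph (w i) then 1 else 0) =
      (level (j + 1) h - level j h) ^ k := by
  classical
  rw [level_gap, ← mean_uniform_forall_mem]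
  simp

/-- The square is wasted when every offered vertex has degree at least `j + 1`, whatever the
strategy does; given the history this has probability gap^k. Jensen's inequality for the `k`-th
power replaces the mean of gap^k by the power of the mean gap, which closes the recursion for the
means. -/
lemma mean_level_succ_le (S : Strategy k n) (t j : ℕ) :
    mean (historyLaw S (t + 1)) (level (j + 1)) ≤ mean (historyLaw S t) (level (j + 1)) +
      1 / n *
        (2 - (mean (historyLaw S t) (level (j + 1)) - mean (historyLaw S t) (level j)) ^ k) := by
  have hn : (0 : ℝ) < n := by exact_mod_cast NeZero.pos n
  have key : ∀ h : History n t, (mean (PMF.uniformOfFintype (Fin k → Fin n)) fun w =>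
      mean (S t h w) fun p => level (j + 1) (Fin.snoc h (w p.1, p.2) : History n (t + 1))) ≤
      level (j + 1) h + 1 / n * (2 - (level (j + 1) h - level j h) ^ k) := by
    intro h
    have hw : ∀ w : Fin k → Fin n, (mean (S t h w) fun p =>
        level (j + 1) (Fin.snoc h (w p.1, p.2) : History n (t + 1))) ≤
        (level (j + 1) h + 1 / n * 2) -
          1 / n * if ∀ i, j + 1 ≤ degree h.graph (w i) then 1 else 0 := by
      intro w
      rw [← mean_const (S t h w) (_ - _)]
      refine mean_mono _ fun p => ?_
      have h1 := total_snoc_le (j + 1) h (w p.1) p.2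
      have h2 : (total (j + 1) (Fin.snoc h (w p.1, p.2) : History n (t + 1)) : ℝ) ≤
          total (j + 1) h + 2 - if ∀ i, j + 1 ≤ degree h.graph (w i) then 1 else 0 := by
        split_ifs with hc
        · rw [if_neg (not_lt.2 (hc p.1))] at h1
          have : (total (j + 1) (Fin.snoc h (w p.1, p.2) : History n (t + 1)) : ℝ) ≤
            total (j + 1) h + 1 + 0 := by exact_mod_cast h1
          linarith
        · have h3 : total (j + 1) (Fin.snoc h (w p.1, p.2) : History n (t + 1)) ≤
              total (j + 1) h + 2 := by split_ifs at h1 <;> omega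
          have : (total (j + 1) (Fin.snoc h (w p.1, p.2) : History n (t + 1)) : ℝ) ≤
            total (j + 1) h + 2 := by exact_mod_cast h3
          linarith
      unfold level
      calc _ ≤ (total (j + 1) h + 2 -
            if ∀ i, j + 1 ≤ degree h.graph (w i) then 1 else 0 : ℝ) / n := by gcongr
        _ = _ := by ring
    refine (mean_mono _ hw).trans (le_of_eq ?_)
    rw [mean_sub, mean_const, mean_const_mul, mean_forall_le_degree]
    ring
  rw [mean_historyLaw_succ]
  refine (mean_mono _ key).trans ?_
  rw [mean_add, mean_const_mul, mean_sub, mean_const]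
  have := pow_mean_le (historyLaw S t) (f := fun h => level (j + 1) h - level j h)
    (fun h => (level_gap_mem j h).1) k
  rw [mean_sub] at this
  gcongr

/-- A strategy is greedy if the circle is a vertex of minimum degree, and the selected square has
minimum degree among the squares offered. -/
def IsGreedy (S : Strategy k n) : Prop :=
  ∀ t (h : History n t), ∃ v, (∀ x, degree h.graph v ≤ degree h.graph x) ∧
    ∀ w, ∃ i, S t h w = PMF.pure (i, v) ∧ ∀ i', degree h.graph (w i) ≤ degree h.graph (w i')

lemma exists_isGreedy (hk : 1 ≤ k) : ∃ S : Strategy k n, IsGreedy S := by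
  have : Nonempty (Fin k) := ⟨⟨0, hk⟩⟩
  have hv : ∀ t (h : History n t), ∃ v, ∀ x, degree h.graph v ≤ degree h.graph x :=
    fun t h => Finite.exists_min _
  have hi : ∀ t (h : History n t) (w : Fin k → Fin n),
      ∃ i, ∀ i', degree h.graph (w i) ≤ degree h.graph (w i') :=
    fun t h w => Finite.exists_min fun i => degree h.graph (w i)
  choose v hv using hv
  choose i hi using hi
  exact ⟨fun t h w => PMF.pure (i t h w, v t h), fun t h => ⟨v t h, hv t h, fun w =>
    ⟨i t h w, rfl, hi t h w⟩⟩⟩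

/-- A union bound for the probability that one of the `k` offered squares is the circle, the only
case in which a loop can arise under the greedy strategy. -/
lemma one_sub_pow_le (k n : ℕ) [NeZero n] : 1 - (((n - 1 : ℕ) : ℝ) / n) ^ k ≤ k * (1 / n) := by
  have hn : (1 : ℝ) ≤ n := by exact_mod_cast NeZero.one_le
  have e : ((n - 1 : ℕ) : ℝ) / n = 1 + -(1 / n) := by
    rw [Nat.cast_sub NeZero.one_le]; field_simp; ring
  have h1 : (1 : ℝ) / n ≤ 1 := by rw [div_le_one (by linarith)]; exact hn
  have := one_add_mul_le_pow (a := -(1 / (n : ℝ))) (by linarith) k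
  rw [e]; linarith

/-- As long as the level is not full, a vertex of minimum degree lies below the threshold, so the
circle counts; the square of smallest degree counts unless all offered ones are above it. The greedy
choice does not depend on `j`, so all levels are optimal simultaneously, up to the loss `k / n ^ 2`
from loops. -/
lemma IsGreedy.le_mean_level {S : Strategy k n} (hS : IsGreedy S) {t : ℕ} (h : History n t) {j : ℕ}
    (hj : level (j + 1) h < (j + 1 : ℕ)) :
    level (j + 1) h + 1 / n * (2 - (level (j + 1) h - level j h) ^ k) - k * (1 / n) ^ 2 ≤
      mean (PMF.uniformOfFintype (Fin k → Fin n)) fun w =>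
      mean (S t h w) fun p => level (j + 1) (Fin.snoc h (w p.1, p.2) : History n (t + 1)) := by
  classical
  have hn : (0 : ℝ) < n := by exact_mod_cast NeZero.pos n
  obtain ⟨v, hv, hw⟩ := hS t h
  have hvj : degree h.graph v < j + 1 := by
    by_contra hc
    have := (total_eq_iff (j + 1) h).2 fun x => (not_lt.1 hc).trans (hv x)
    rw [level, div_lt_iff₀ hn] at hj
    have h2 : total (j + 1) h < (j + 1) * n := by exact_mod_cast hj
    rw [mul_comm] at h2
    omega
  have hpt : ∀ w : Fin k → Fin n,
      level (j + 1) h + 1 / n * 1 -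
        1 / n * (if ∀ i, j + 1 ≤ degree h.graph (w i) then 1 else 0) +
        1 / n * (if ∀ i, w i ∈ Finset.univ.erase v then 1 else 0) ≤
      mean (S t h w) fun p => level (j + 1) (Fin.snoc h (w p.1, p.2) : History n (t + 1)) := by
    intro w
    obtain ⟨i, hi, hmin⟩ := hw w
    rw [hi, mean_pure]
    have h1 := le_total_snoc (j + 1) h (w i) v hvj
    have h2 : (total (j + 1) h : ℝ) + 1 - (if ∀ i, j + 1 ≤ degree h.graph (w i) then 1 else 0) +
        (if ∀ i, w i ∈ Finset.univ.erase v then 1 else 0) ≤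
        total (j + 1) (Fin.snoc h (w i, v) : History n (t + 1)) := by
      have h3 : total (j + 1) h + 1 + (if ∀ i, w i ∈ Finset.univ.erase v then 1 else 0) ≤
          total (j + 1) (Fin.snoc h (w i, v) : History n (t + 1)) +
            (if ∀ i, j + 1 ≤ degree h.graph (w i) then 1 else 0) := by
        by_cases hA : ∀ i, w i ∈ Finset.univ.erase v
        · have hne : w i ≠ v := Finset.ne_of_mem_erase (hA i)
          rw [if_neg hne] at h1
          rw [if_pos hA]
          by_cases hB : ∀ i, j + 1 ≤ degree h.graph (w i)
          · rw [if_pos hB]; split_ifs at h1 <;> omega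
          · rw [if_neg hB]
            have : degree h.graph (w i) < j + 1 := by
              by_contra hc
              exact hB fun i' => (not_lt.1 hc).trans (hmin i')
            rw [if_pos this] at h1
            omega
        · rw [if_neg hA]
          by_cases hB : ∀ i, j + 1 ≤ degree h.graph (w i)
          · rw [if_pos hB]; split_ifs at h1 <;> omega
          · rw [if_neg hB]
            have : degree h.graph (w i) < j + 1 := by
              by_contra hc
              exact hB fun i' => (not_lt.1 hc).trans (hmin i')
            rw [if_pos this] at h1
            split_ifs at h1 <;> omega
      have h4 : (total (j + 1) h : ℝ) + 1 + (if ∀ i, w i ∈ Finset.univ.erase v then 1 else 0) ≤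
          total (j + 1) (Fin.snoc h (w i, v) : History n (t + 1)) +
            (if ∀ i, j + 1 ≤ degree h.graph (w i) then 1 else 0) := by exact_mod_cast h3
      linarith
    unfold level
    calc _ = ((total (j + 1) h : ℝ) + 1 -
          (if ∀ i, j + 1 ≤ degree h.graph (w i) then 1 else 0) +
          (if ∀ i, w i ∈ Finset.univ.erase v then 1 else 0)) / n := by ring
      _ ≤ _ := by gcongr
  refine le_trans ?_ (mean_mono _ hpt)
  rw [mean_add, mean_sub, mean_const, mean_const_mul, mean_const_mul, mean_forall_le_degree,
    mean_uniform_forall_mem, Finset.card_erase_of_mem (Finset.mem_univ v), Finset.card_univ,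
    Fintype.card_fin]
  have h5 := mul_le_mul_of_nonneg_left (one_sub_pow_le k n) (one_div_pos.2 hn).le
  linarith

end Round

/-! ### No strategy beats the fluid limit -/

/-- The Euler map sending (m, m') to m + ε(2 - (m - m')^k) is monotone in both arguments for gaps in
the unit interval, provided `k * ε ≤ 1`. Errors therefore add up without amplification, by `2 * k *
ε ^ 2` per round. -/
lemma IsFluid.mean_level_le {k : ℕ} {X : ℕ → ℝ} {d : ℕ → ℝ → ℝ} (hF : IsFluid k X d) {n : ℕ}
    [NeZero n] (hkn : k ≤ n) (S : Strategy k n) (t j : ℕ) :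
    mean (historyLaw S t) (level j) ≤ d j (t * (1 / n)) + t * (2 * k * (1 / n : ℝ) ^ 2) := by
  have hn : (0 : ℝ) < n := by exact_mod_cast NeZero.pos n
  set ε : ℝ := 1 / n with hε
  have hε0 : 0 < ε := one_div_pos.2 hn
  induction t generalizing j with
  | zero =>
    rw [historyLaw, mean_pure]
    simp [level, total, degree_graph, (hF.saturating j).init]
  | succ t ih =>
    have ht0 : 0 ≤ (t : ℝ) * ε := by positivity
    have e : ((t + 1 : ℕ) : ℝ) * ε = t * ε + ε := by push_cast; ring
    have e' : ((t + 1 : ℕ) : ℝ) * (2 * k * ε ^ 2) = t * (2 * k * ε ^ 2) + 2 * k * ε ^ 2 := by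
      push_cast; ring
    rw [e, e']
    cases j with
    | zero =>
      simp only [hF.zero]
      have : mean (historyLaw S (t + 1)) (level 0) = 0 := by
        rw [show (level 0 : History n (t + 1) → ℝ) = fun _ => 0 from funext level_zero, mean_const]
      rw [this]; positivity
    | succ j =>
      rcases le_total (X (j + 1)) (t * ε + ε) with hX | hX
      · rw [(hF.saturating _).saturated _ hX]
        have : mean (historyLaw S (t + 1)) (level (j + 1)) ≤ ((j + 1 : ℕ) : ℝ) := by
          rw [← mean_const (historyLaw S (t + 1)) ((j + 1 : ℕ) : ℝ)]
          exact mean_mono _ fun h => level_le _ h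
        have h2 : 0 ≤ (t : ℝ) * (2 * k * ε ^ 2) + 2 * k * ε ^ 2 := by positivity
        linarith
      · have h1 := hF.le_sub_step j ht0 hε0.le hX
        have h2 := mean_level_succ_le S t j
        have h3 := ih (j + 1)
        have h4 := ih j
        have hz := hF.gap_mem j ht0
        have hm : mean (historyLaw S t) (level (j + 1)) - mean (historyLaw S t) (level j) ∈
            Icc (0 : ℝ) 1 := by
          rw [← mean_sub]
          constructor
          · exact mean_nonneg _ fun h => (level_gap_mem j h).1
          · rw [← mean_const (historyLaw S t) 1]
            exact mean_mono _ fun h => (level_gap_mem j h).2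
        rw [← hε] at h2
        set m := mean (historyLaw S t) (level (j + 1))
        set m' := mean (historyLaw S t) (level j)
        set D := d (j + 1) (t * ε)
        set D' := d j (t * ε)
        set E := (t : ℝ) * (2 * k * ε ^ 2)
        rcases le_total (D - D') (m - m') with hle | hle
        · have := pow_le_pow_left₀ hz.1 hle k
          have := mul_le_mul_of_nonneg_left this hε0.le
          linarith
        -- With p = kε ≤ 1, the new mean is at most (1 - p) m + p m' + p (D - D') plus the common
        -- drift. Inserting m ≤ D + E and m' ≤ D' + E with weights 1 - p and p gives exactly D + E.
        · have h5 := (abs_le.1 (abs_pow_sub_pow_le_of_mem_Icc (k := k) hz hm)).2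
          rw [abs_of_nonneg (by linarith)] at h5
          have hkε : k * ε ≤ 1 := by
            rw [hε, mul_one_div, div_le_one hn]; exact_mod_cast hkn
          have h6 := mul_le_mul_of_nonneg_left h5 hε0.le
          have h7 : 0 ≤ k * ε := by positivity
          have h8 := mul_le_mul_of_nonneg_left h3 (sub_nonneg.2 hkε)
          have h9 := mul_le_mul_of_nonneg_left h4 h7
          nlinarith

/-! ### The greedy strategy follows the fluid limit -/

/-- The amount by which the level of the history falls short of the fluid limit. -/
def deficit (d : ℕ → ℝ → ℝ) {n t : ℕ} (j : ℕ) (h : History n t) : ℝ :=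
  max 0 (d j (t * (1 / n)) - level j h)

/-- A second-order Taylor bound for the square of the positive part. The linear term carries the
factor `max 0 a`, so a drift estimate is needed only where the deficit is positive. -/
lemma max_zero_add_sq_le (a b : ℝ) :
    max 0 (a + b) ^ 2 ≤ max 0 a ^ 2 + 2 * max 0 a * b + b ^ 2 := by
  rcases le_total 0 a with ha | ha <;> rcases le_total 0 (a + b) with hb | hb <;>
    simp only [ha, hb, max_eq_left, max_eq_right] <;> nlinarith [sq_nonneg (a + b), sq_nonneg b]

section GreedyUpper

variable {k : ℕ} {X : ℕ → ℝ} {d : ℕ → ℝ → ℝ} {n : ℕ} [NeZero n] {S : Strategy k n}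

/-- If the deficit is positive, the level is below `j + 1` and the greedy drift bound applies. The
actual gap then exceeds the fluid gap by at most the deficit at `j`, which gives the term with
factor `k`. The constant 3k collects 2k from the Euler step and k from loops; the last term comes
from increments lying in `[0, 2 / n]`. -/
lemma IsGreedy.mean_deficit_sq_le (hS : IsGreedy S) (hF : IsFluid k X d) {t : ℕ}
    (h : History n t) (j : ℕ) :
    (mean (PMF.uniformOfFintype (Fin k → Fin n)) fun w => mean (S t h w) fun p =>
      deficit d (j + 1) (Fin.snoc h (w p.1, p.2) : History n (t + 1)) ^ 2) ≤
    deficit d (j + 1) h ^ 2 +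
      2 * deficit d (j + 1) h * (1 / n * (k * deficit d j h) + 3 * k * (1 / n) ^ 2) +
      4 * (1 / n) ^ 2 := by
  have hn : (0 : ℝ) < n := by exact_mod_cast NeZero.pos n
  set ε : ℝ := 1 / n with hε
  have hε0 : 0 < ε := one_div_pos.2 hn
  have ht0 : 0 ≤ (t : ℝ) * ε := by positivity
  have e : ((t + 1 : ℕ) : ℝ) * ε = t * ε + ε := by push_cast; ring
  set P := deficit d (j + 1) h with hP
  have hP0 : 0 ≤ P := le_max_left _ _
  have hP0' : 0 ≤ deficit d j h := le_max_left _ _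
  set Δ := d (j + 1) (t * ε + ε) - d (j + 1) (t * ε) with hΔ
  have hΔm : Δ ∈ Icc 0 (2 * ε) := by
    have := (hF.saturating (j + 1)).monotone_sub ht0 (by linarith : (t : ℝ) * ε ≤ t * ε + ε)
    rwa [add_sub_cancel_left] at this
  have hpt : ∀ (w : Fin k → Fin n) (p : Fin k × Fin n),
      deficit d (j + 1) (Fin.snoc h (w p.1, p.2) : History n (t + 1)) ^ 2 ≤
      (P ^ 2 + 2 * P * (Δ + level (j + 1) h) + 4 * ε ^ 2) -
        2 * P * level (j + 1) (Fin.snoc h (w p.1, p.2) : History n (t + 1)) := by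
    intro w p
    have hl := level_snoc_sub_mem (j + 1) h (w p.1) p.2
    rw [← hε] at hl
    have h1 := max_zero_add_sq_le (d (j + 1) (t * ε) - level (j + 1) h)
      (Δ - (level (j + 1) (Fin.snoc h (w p.1, p.2) : History n (t + 1)) - level (j + 1) h))
    have e1 : deficit d (j + 1) (Fin.snoc h (w p.1, p.2) : History n (t + 1)) =
        max 0 (d (j + 1) (t * ε) - level (j + 1) h +
        (Δ - (level (j + 1) (Fin.snoc h (w p.1, p.2) : History n (t + 1)) -
          level (j + 1) h))) := by
      rw [deficit, ← hε, e, hΔ]; congr 1; ring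
    have e2 : max 0 (d (j + 1) (t * ε) - level (j + 1) h) = P := by rw [hP, deficit]
    rw [← e1, e2] at h1
    have h2 : (Δ - (level (j + 1) (Fin.snoc h (w p.1, p.2) : History n (t + 1)) -
        level (j + 1) h)) ^ 2 ≤ (2 * ε) ^ 2 := by
      apply sq_le_sq'
      · linarith [hΔm.1, hl.2]
      · linarith [hΔm.2, hl.1]
    nlinarith
  refine (mean_mono _ fun w => mean_mono _ (hpt w)).trans ?_
  simp only [mean_sub, mean_const, mean_const_mul]
  rcases hP0.eq_or_lt with h0 | hpos
  · rw [← h0]; simp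
  · have hlt : level (j + 1) h < d (j + 1) (t * ε) := by
      by_contra hc
      have : P = 0 := by
        rw [hP, deficit, ← hε]; exact max_eq_left (by linarith)
      linarith
    have hlj : level (j + 1) h < (j + 1 : ℕ) := hlt.trans_le ((hF.saturating _).le ht0)
    have h1 := hS.le_mean_level h hlj
    have h2 := hF.sub_le_step j ht0 hε0.le
    rw [← hΔ] at h2
    rw [← hε] at h1
    have hz := hF.gap_mem j ht0
    have hZ := level_gap_mem j h
    have h3 : (level (j + 1) h - level j h) ^ k - (d (j + 1) (t * ε) - d j (t * ε)) ^ k ≤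
        k * deficit d j h := by
      rcases le_total (level (j + 1) h - level j h) (d (j + 1) (t * ε) - d j (t * ε)) with hc | hc
      · have := pow_le_pow_left₀ hZ.1 hc k
        have : 0 ≤ k * deficit d j h := by positivity
        linarith
      · have h5 := (abs_le.1 (abs_pow_sub_pow_le_of_mem_Icc (k := k) hZ hz)).2
        rw [abs_of_nonneg (by linarith)] at h5
        refine h5.trans (mul_le_mul_of_nonneg_left ?_ (Nat.cast_nonneg k))
        have : d j (t * ε) - level j h ≤ deficit d j h := by
          rw [deficit, ← hε]; exact le_max_right _ _
        linarith
    have h4 := mul_le_mul_of_nonneg_left h3 hε0.le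
    set L := mean (PMF.uniformOfFintype (Fin k → Fin n)) fun w =>
      mean (S t h w) fun p => level (j + 1) (Fin.snoc h (w p.1, p.2) : History n (t + 1))
    have h6 : Δ + level (j + 1) h - L ≤ ε * (k * deficit d j h) + 3 * k * ε ^ 2 := by nlinarith
    have := mul_le_mul_of_nonneg_left h6 (by linarith : 0 ≤ 2 * P)
    linarith

/-- Discrete Grönwall with a bound uniform in `j`: after 2PQ ≤ P² + Q² and 2P ≤ P² + 1, the
coefficients of the two squared deficits are 1 + 4kε and kε. For t of order n the result is of order
1/n, so no concentration inequality beyond the second moment is needed. -/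
lemma IsGreedy.mean_deficit_sq_le_pow (hS : IsGreedy S) (hF : IsFluid k X d) (t j : ℕ) :
    mean (historyLaw S t) (fun h => deficit d j h ^ 2) ≤
      t * ((3 * k + 4) * (1 / n : ℝ) ^ 2) * (1 + 5 * k * (1 / n : ℝ)) ^ t := by
  have hn : (1 : ℝ) ≤ n := by exact_mod_cast NeZero.one_le
  set ε : ℝ := 1 / n with hε
  have hε0 : 0 < ε := one_div_pos.2 (by linarith)
  have hε1 : ε ≤ 1 := by rw [hε, div_le_one (by linarith)]; exact hn
  induction t generalizing j with
  | zero =>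
    rw [historyLaw, mean_pure]
    simp [deficit, level, total, degree_graph, (hF.saturating j).init]
  | succ t ih =>
    set A : ℝ := (3 * k + 4) * ε ^ 2 with hA
    have hA0 : 0 ≤ A := by positivity
    set B : ℝ := 1 + 5 * k * ε with hB
    have hB1 : 1 ≤ B := by
      have : 0 ≤ 5 * k * ε := by positivity
      linarith
    cases j with
    | zero =>
      have : ∀ h : History n (t + 1), deficit d 0 h ^ 2 = 0 := fun h => by
        simp [deficit, hF.zero, level_zero]
      simp only [this, mean_const]
      positivity
    | succ j =>
      rw [mean_historyLaw_succ]
      have hpt : ∀ h : History n t,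
          (mean (PMF.uniformOfFintype (Fin k → Fin n)) fun w => mean (S t h w) fun p =>
            deficit d (j + 1) (Fin.snoc h (w p.1, p.2) : History n (t + 1)) ^ 2) ≤
          (1 + 4 * k * ε) * deficit d (j + 1) h ^ 2 + (k * ε * deficit d j h ^ 2 + A) := by
        intro h
        refine (hS.mean_deficit_sq_le hF h j).trans ?_
        rw [← hε]
        set P := deficit d (j + 1) h
        set Q := deficit d j h
        have h1 : 2 * P * Q ≤ P ^ 2 + Q ^ 2 := two_mul_le_add_sq P Q
        have h2 : 2 * P ≤ P ^ 2 + 1 := by nlinarith [sq_nonneg (P - 1)]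
        have h3 := mul_le_mul_of_nonneg_left h1 (by positivity : 0 ≤ ε * k)
        have h4 := mul_le_mul_of_nonneg_left h2 (by positivity : 0 ≤ 3 * k * ε ^ 2)
        have h5 : 3 * k * ε ^ 2 * P ^ 2 ≤ 3 * k * ε * P ^ 2 := by
          have : ε ^ 2 ≤ ε := by nlinarith
          gcongr
        rw [hA]
        nlinarith
      refine (mean_mono _ hpt).trans ?_
      rw [mean_add, mean_add, mean_const_mul, mean_const_mul, mean_const]
      have h1 := mul_le_mul_of_nonneg_left (ih (j + 1)) (by positivity : 0 ≤ 1 + 4 * k * ε)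
      have h2 := mul_le_mul_of_nonneg_left (ih j) (by positivity : 0 ≤ k * ε)
      have h3 : A ≤ A * B ^ (t + 1) := le_mul_of_one_le_right hA0 (one_le_pow₀ hB1)
      calc _ ≤ (1 + 4 * k * ε) * (t * A * B ^ t) + (k * ε * (t * A * B ^ t) + A * B ^ (t + 1)) := by
            linarith
        _ = _ := by rw [hB]; push_cast; ring

/-- The probability that more than `r` units of degree are missing after `t` rounds. -/
def missingProb (S : Strategy k n) (ℓ r t : ℕ) : ℝ :=
  mean (historyLaw S t) fun h => if total ℓ h + r < n * ℓ then 1 else 0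

/-- While the truncated sum is not full, the circle has degree below `ℓ`, so even a loop gains at
least one unit. Hence `s` extra rounds repair a shortage of at most `s` units. -/
lemma IsGreedy.missingProb_succ_le (hS : IsGreedy S) (ℓ r t : ℕ) :
    missingProb S ℓ r (t + 1) ≤ missingProb S ℓ (r + 1) t := by
  rw [missingProb, missingProb, mean_historyLaw_succ]
  refine mean_mono _ fun h => ?_
  obtain ⟨v, hv, hw⟩ := hS t h
  rw [← mean_const (PMF.uniformOfFintype (Fin k → Fin n))
    (if total ℓ h + (r + 1) < n * ℓ then 1 else 0)]
  refine mean_mono _ fun w => ?_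
  obtain ⟨i, hi, -⟩ := hw w
  rw [hi, mean_pure]
  by_cases hc : total ℓ h + (r + 1) < n * ℓ
  · rw [if_pos hc]; split_ifs <;> norm_num
  · rw [if_neg hc, if_neg]
    by_cases hvl : degree h.graph v < ℓ
    · have := le_total_snoc ℓ h (w i) v hvl
      by_cases huv : w i = v
      · rw [if_pos huv, huv, if_pos hvl] at this
        simp only [huv]
        omega
      · rw [if_neg huv] at this
        simp only
        omega
    · have h1 := (total_eq_iff ℓ h).2 fun x => (not_lt.1 hvl).trans (hv x)
      have h2 := total_le_total_snoc ℓ h (w i) v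
      simp only
      omega

lemma IsGreedy.missingProb_add_le (hS : IsGreedy S) (ℓ t s r : ℕ) :
    missingProb S ℓ r (t + s) ≤ missingProb S ℓ (r + s) t := by
  induction s generalizing r with
  | zero => exact le_rfl
  | succ s ih =>
    have := (hS.missingProb_succ_le ℓ r (t + s)).trans (ih (r + 1))
    rwa [show r + 1 + s = r + (s + 1) by omega] at this

lemma successProb_eq (S : Strategy k n) (ℓ t : ℕ) :
    successProb S ℓ t = 1 - missingProb S ℓ 0 t := by
  have h1 := mean_sub (historyLaw S t) (fun _ => 1)
    fun h => if total ℓ h + 0 < n * ℓ then (1 : ℝ) else 0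
  rw [mean_const] at h1
  rw [successProb, missingProb, ← h1]
  congr 1
  funext h
  by_cases hc : n * ℓ ≤ total ℓ h
  · simp [hc, not_lt.2 hc]
  · simp [hc, not_le.1 hc]

/-- Chebyshev's argument: after the time `X ℓ` the fluid limit equals `ℓ`, so more than `r` missing
units force a deficit of at least `r / n`. -/
lemma missingProb_le (S : Strategy k n) (hF : IsFluid k X d) {ℓ r t : ℕ} (ht : X ℓ ≤ t * (1 / n)) :
    (r * (1 / n : ℝ)) ^ 2 * missingProb S ℓ r t ≤
      mean (historyLaw S t) fun h => deficit d ℓ h ^ 2 := by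
  have hn : (0 : ℝ) < n := by exact_mod_cast NeZero.pos n
  rw [missingProb, ← mean_const_mul]
  refine mean_mono _ fun h => ?_
  split_ifs with hc
  · rw [mul_one]
    have : r * (1 / n : ℝ) ≤ deficit d ℓ h := by
      refine le_trans ?_ (le_max_right _ _)
      rw [(hF.saturating ℓ).saturated _ ht, level, mul_one_div, le_sub_iff_add_le, ← add_div,
        div_le_iff₀ hn]
      have : ((r + total ℓ h : ℕ) : ℝ) ≤ (ℓ * n : ℕ) := by
        exact_mod_cast (by rw [mul_comm ℓ n]; omega)
      push_cast at this
      linarith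
    gcongr
  · simp only [mul_zero]; positivity

end GreedyUpper

/-! ### The threshold -/

lemma hitTime_le {P : ∀ n, MultiGraph n → Prop} {p : ℝ} {n k : ℕ} [NeZero n] (S : Strategy k n)
    {t : ℕ} (h : ENNReal.ofReal p ≤ (graphLaw S t).toOuterMeasure {G | P n G}) :
    hitTime P p n k ≤ t :=
  (iInf_le _ S).trans (iInf₂_le t h)

lemma le_hitTime {P : ∀ n, MultiGraph n → Prop} {p : ℝ} {n k : ℕ} [NeZero n] {m : ℕ}
    (h : ∀ (S : Strategy k n) (t : ℕ), t < m →
      (graphLaw S t).toOuterMeasure {G | P n G} < ENNReal.ofReal p) :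
    (m : ℕ∞) ≤ hitTime P p n k := by
  refine le_iInf fun S => le_iInf₂ fun t ht => ?_
  by_contra hc
  exact absurd ht (not_le.2 (h S t (by exact_mod_cast not_le.1 hc)))

namespace IsFluid

variable {k : ℕ} {X : ℕ → ℝ} {d : ℕ → ℝ → ℝ}

lemma exists_successProb_ge (hF : IsFluid k X d) (hk : 1 ≤ k) (ℓ : ℕ) {ε p : ℝ} (hε : 0 < ε)
    (hp : p < 1) : ∀ᶠ m : ℕ in atTop, ∃ (S : Strategy k (m + 1)) (t : ℕ),
      (t : ℝ) ≤ (X ℓ + ε) * (m + 1 : ℕ) ∧ p ≤ successProb S ℓ t := by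
  have hX0 := (hF.saturating ℓ).nonneg
  set C : ℝ := (X ℓ + 1) * (3 * k + 4) * Real.exp (5 * k * (X ℓ + 1)) / (ε / 2) ^ 2 with hC
  have hC0 : 0 ≤ C := by positivity
  have hlim : Tendsto (fun m : ℕ => (((m + 1 : ℕ) : ℝ))) atTop atTop :=
    tendsto_natCast_atTop_atTop.comp (tendsto_add_atTop_nat 1)
  filter_upwards [hlim.eventually_ge_atTop (C / (1 - p)), hlim.eventually_ge_atTop (4 / ε)]
    with m hm1 hm2
  set n := m + 1 with hn
  have hn1 : (1 : ℝ) ≤ n := by rw [hn]; push_cast; linarith [Nat.cast_nonneg (α := ℝ) m]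
  have hn0 : (0 : ℝ) < n := by linarith
  obtain ⟨S, hS⟩ := exists_isGreedy (k := k) (n := n) hk
  -- The first `t` rounds follow the fluid limit to saturation and the next `s` rounds fill in what
  -- is missing. The condition `n ≥ 4 / ε` absorbs the two roundings.
  set t := ⌈X ℓ * n⌉₊ with ht
  set s := ⌈ε / 2 * n⌉₊ with hs
  have ht1 : X ℓ * n ≤ t := Nat.le_ceil _
  have ht2 : (t : ℝ) < X ℓ * n + 1 := Nat.ceil_lt_add_one (by positivity)
  have hs1 : ε / 2 * n ≤ s := Nat.le_ceil _
  have hs2 : (s : ℝ) < ε / 2 * n + 1 := Nat.ceil_lt_add_one (by positivity)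
  have h4 : 4 ≤ ε * n := by rw [div_le_iff₀ hε] at hm2; linarith
  refine ⟨S, t + s, by rw [Nat.cast_add]; linarith, ?_⟩
  have hXt : X ℓ ≤ t * (1 / n) := by rw [mul_one_div, le_div_iff₀ hn0]; exact ht1
  have h1 := missingProb_le S hF (r := s) hXt
  have h2 := hS.mean_deficit_sq_le_pow hF t ℓ
  have h3 := hS.missingProb_add_le ℓ t s 0
  rw [zero_add] at h3
  have htn : (t : ℝ) * (1 / n) ≤ X ℓ + 1 := by
    rw [mul_one_div, div_le_iff₀ hn0]; nlinarith
  have hexp : (1 + 5 * k * (1 / n : ℝ)) ^ t ≤ Real.exp (5 * k * (X ℓ + 1)) := by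
    calc (1 + 5 * k * (1 / n : ℝ)) ^ t ≤ Real.exp (5 * k * (1 / n : ℝ)) ^ t := by
          gcongr
          rw [add_comm]; exact Real.add_one_le_exp _
      _ = Real.exp (5 * k * (t * (1 / n : ℝ))) := by
          rw [← Real.exp_nat_mul]; congr 1; ring
      _ ≤ _ := by gcongr
  have hsn : ε / 2 ≤ s * (1 / n : ℝ) := by rw [mul_one_div, le_div_iff₀ hn0]; exact hs1
  have hM0 : 0 ≤ missingProb S ℓ s t := mean_nonneg _ fun h => by split_ifs <;> norm_num
  have h5 : (ε / 2) ^ 2 * missingProb S ℓ s t ≤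
      (X ℓ + 1) * (3 * k + 4) * Real.exp (5 * k * (X ℓ + 1)) * (1 / n) := by
    calc (ε / 2) ^ 2 * missingProb S ℓ s t ≤ (s * (1 / n : ℝ)) ^ 2 * missingProb S ℓ s t := by
          gcongr
      _ ≤ _ := h1.trans h2
      _ = (t * (1 / n : ℝ)) * (3 * k + 4) * (1 + 5 * k * (1 / n : ℝ)) ^ t * (1 / n) := by ring
      _ ≤ _ := by gcongr
  have h6 : missingProb S ℓ s t ≤ C * (1 / n) := by
    rw [hC, div_mul_eq_mul_div, le_div_iff₀ (by positivity)]
    linarith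
  have h7 : C * (1 / n) ≤ 1 - p := by
    rw [mul_one_div, div_le_iff₀ hn0]
    rw [div_le_iff₀ (by linarith)] at hm1
    linarith
  rw [successProb_eq]
  linarith

/-- Before `X ℓ` the fluid limit falls short of `ℓ` by some `δ > 0`, so for large `n` the mean level
is below `ℓ - δ / 2`. As a success contributes the level `ℓ`, Markov's inequality gives `p₀ = 1 - δ
/ (2 * ℓ)`. This excludes only probabilities near 1, which is what the limit `p → 1` asks for. -/
lemma exists_successProb_lt (hF : IsFluid k X d) {ℓ : ℕ} (hℓ : 1 ≤ ℓ) {x : ℝ} (hx : 0 ≤ x)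
    (hxX : x < X ℓ) : ∃ p₀ < (1 : ℝ), 0 < p₀ ∧ ∀ᶠ m : ℕ in atTop,
      ∀ (S : Strategy k (m + 1)) (t : ℕ), (t : ℝ) ≤ x * (m + 1 : ℕ) → successProb S ℓ t < p₀ := by
  have hℓ0 : (0 : ℝ) < ℓ := by exact_mod_cast hℓ
  set δ : ℝ := ℓ - d ℓ x with hδ
  have hδ0 : 0 < δ := by linarith [(hF.saturating ℓ).lt_of_lt hx hxX]
  have hδℓ : δ ≤ ℓ := by
    have := ((hF.saturating ℓ).monotone_sub le_rfl hx).1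
    rw [(hF.saturating ℓ).init] at this
    linarith
  refine ⟨1 - δ / (2 * ℓ), ?_, ?_, ?_⟩
  · have : 0 < δ / (2 * ℓ) := by positivity
    linarith
  · have : δ / (2 * ℓ) ≤ 1 / 2 := by rw [div_le_iff₀ (by positivity)]; linarith
    linarith
  have hlim : Tendsto (fun m : ℕ => (((m + 1 : ℕ) : ℝ))) atTop atTop :=
    tendsto_natCast_atTop_atTop.comp (tendsto_add_atTop_nat 1)
  filter_upwards [hlim.eventually_gt_atTop (x * (2 * k) / (δ / 2)), eventually_ge_atTop k]
    with m hm hkm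
  set n := m + 1 with hn
  intro S t ht
  have hn1 : (1 : ℝ) ≤ n := by rw [hn]; push_cast; linarith [Nat.cast_nonneg (α := ℝ) m]
  have hn0 : (0 : ℝ) < n := by linarith
  have h1 := hF.mean_level_le (n := n) (by omega) S t ℓ
  have htx : (t : ℝ) * (1 / n) ≤ x := by rw [mul_one_div, div_le_iff₀ hn0]; exact ht
  have h2 := ((hF.saturating ℓ).monotone_sub (by positivity : 0 ≤ (t : ℝ) * (1 / n)) htx).1
  have h3 : (t : ℝ) * (2 * k * (1 / n : ℝ) ^ 2) < δ / 2 := by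
    calc (t : ℝ) * (2 * k * (1 / n : ℝ) ^ 2) = (t * (1 / n)) * (2 * k) * (1 / n) := by ring
      _ ≤ x * (2 * k) * (1 / n) := by gcongr
      _ < δ / 2 := by
        rw [mul_one_div, div_lt_iff₀ hn0]
        rw [div_lt_iff₀ (by positivity)] at hm
        linarith
  have h4 : ℓ * successProb S ℓ t ≤ mean (historyLaw S t) (level ℓ) := by
    rw [successProb, ← mean_const_mul]
    refine mean_mono _ fun h => ?_
    split_ifs with hc
    · rw [mul_one, level, le_div_iff₀ hn0]
      have : ((n * ℓ : ℕ) : ℝ) ≤ total ℓ h := by exact_mod_cast hc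
      push_cast at this ⊢
      linarith
    · rw [mul_zero]; exact level_nonneg _ _
  have e : (ℓ : ℝ) * (1 - δ / (2 * ℓ)) = ℓ - δ / 2 := by field_simp
  refine lt_of_mul_lt_mul_left ?_ hℓ0.le
  rw [e]
  linarith

lemma upperRate_le (hF : IsFluid k X d) (hk : 1 ≤ k) (ℓ : ℕ) {p : ℝ} (hp : p < 1) {ε : ℝ}
    (hε : 0 < ε) : upperRate (MinDegreeAtLeast ℓ) k p ≤ ENNReal.ofReal (X ℓ + ε) := by
  refine limsup_le_of_le (by isBoundedDefault) ?_
  filter_upwards [hF.exists_successProb_ge hk ℓ hε hp] with m ⟨S, t, ht, hSp⟩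
  have h1 : hitTime (MinDegreeAtLeast ℓ) p (m + 1) k ≤ t := hitTime_le S <| by
    rw [graphLaw_minDegree]; exact ENNReal.ofReal_le_ofReal hSp
  have h2 : (hitTime (MinDegreeAtLeast ℓ) p (m + 1) k : ℝ≥0∞) ≤ (t : ℝ≥0∞) := by
    exact_mod_cast ENat.toENNReal_le.2 h1
  refine ENNReal.div_le_of_le_mul (h2.trans ?_)
  have hX0 := (hF.saturating ℓ).nonneg
  rw [← ENNReal.ofReal_natCast, ← ENNReal.ofReal_natCast, ← ENNReal.ofReal_mul (by linarith)]
  exact ENNReal.ofReal_le_ofReal ht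

lemma le_upperRate (hF : IsFluid k X d) {ℓ : ℕ} (hℓ : 1 ≤ ℓ) {x : ℝ} (hx : 0 ≤ x)
    (hxX : x < X ℓ) : ∃ p₀ < (1 : ℝ), ∀ p, p₀ ≤ p →
      ENNReal.ofReal x ≤ upperRate (MinDegreeAtLeast ℓ) k p := by
  obtain ⟨p₀, hp₀, hpos, hev⟩ := hF.exists_successProb_lt hℓ hx hxX
  refine ⟨p₀, hp₀, fun p hp => ?_⟩
  refine le_limsup_of_frequently_le (Eventually.frequently ?_) (by isBoundedDefault)
  filter_upwards [hev] with m hm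
  have h1 : ((⌈x * (m + 1 : ℕ)⌉₊ : ℕ) : ℕ∞) ≤ hitTime (MinDegreeAtLeast ℓ) p (m + 1) k := by
    refine le_hitTime fun S t ht => ?_
    rw [graphLaw_minDegree]
    refine (ENNReal.ofReal_lt_ofReal_iff (hpos.trans_le hp)).2 (lt_of_lt_of_le ?_ hp)
    exact hm S t (Nat.lt_ceil.1 ht).le
  have h2 : ((⌈x * (m + 1 : ℕ)⌉₊ : ℕ) : ℝ≥0∞) ≤
      (hitTime (MinDegreeAtLeast ℓ) p (m + 1) k : ℝ≥0∞) := by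
    exact_mod_cast ENat.toENNReal_le.2 h1
  rw [ENNReal.le_div_iff_mul_le (Or.inl (by simp)) (Or.inl (by simp))]
  refine le_trans ?_ h2
  rw [← ENNReal.ofReal_natCast, ← ENNReal.ofReal_natCast, ← ENNReal.ofReal_mul hx]
  exact ENNReal.ofReal_le_ofReal (Nat.le_ceil _)

theorem tauEq (hF : IsFluid k X d) (hk : 1 ≤ k) {ℓ : ℕ} (hℓ : 1 ≤ ℓ) :
    TauEq (MinDegreeAtLeast ℓ) k (ENNReal.ofReal (X ℓ)) := by
  have hle : ∀ p < 1, upperRate (MinDegreeAtLeast ℓ) k p ≤ ENNReal.ofReal (X ℓ) := by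
    intro p hp
    have hlim : Tendsto (fun ε : ℝ => ENNReal.ofReal (X ℓ + ε)) (𝓝[>] 0)
        (𝓝 (ENNReal.ofReal (X ℓ + 0))) :=
      ((ENNReal.continuous_ofReal.comp (continuous_const.add continuous_id)).tendsto 0).mono_left
        nhdsWithin_le_nhds
    rw [add_zero] at hlim
    refine ge_of_tendsto hlim ?_
    filter_upwards [self_mem_nhdsWithin] with ε hε using hF.upperRate_le hk ℓ hp hε
  refine tendsto_order.2 ⟨fun a ha => ?_, fun a ha => ?_⟩
  · obtain ⟨x, hx, hax, hxX⟩ : ∃ x : ℝ, 0 ≤ x ∧ a < ENNReal.ofReal x ∧ x < X ℓ := by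
      obtain ⟨r, har, hr⟩ := ENNReal.lt_iff_exists_nnreal_btwn.1 ha
      refine ⟨r, r.2, by rwa [ENNReal.ofReal_coe_nnreal], ?_⟩
      rw [← ENNReal.ofReal_coe_nnreal] at hr
      exact (ENNReal.ofReal_lt_ofReal_iff_of_nonneg r.coe_nonneg).1 hr
    obtain ⟨p₀, hp₀, h⟩ := hF.le_upperRate hℓ hx hxX
    filter_upwards [Ioo_mem_nhdsLT hp₀] with p hp using hax.trans_le (h p hp.1.le)
  · filter_upwards [self_mem_nhdsWithin] with p hp using (hle p hp).trans_lt ha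

end IsFluid

/-! ### Integer polynomials as coefficient lists -/

/-- The value at `s` of the polynomial with the given coefficients. -/
def pev : List ℤ → ℝ → ℝ
  | [], _ => 0
  | a :: l, s => a + s * pev l s

/-- The coefficients of `a * m + r`. -/
def addMul (a : ℤ) : List ℤ → List ℤ → List ℤ
  | [], r => r
  | b :: m, [] => a * b :: addMul a m []
  | b :: m, c :: r => (a * b + c) :: addMul a m r

/-- The coefficients of the product. -/
def pmul : List ℤ → List ℤ → List ℤ
  | [], _ => []
  | a :: l, m => addMul a m (0 :: pmul l m)

/-- The coefficients of the `k`-th power. -/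
def ppow (l : List ℤ) : ℕ → List ℤ
  | 0 => [1]
  | k + 1 => pmul l (ppow l k)

/-- The coefficients of the derivative. -/
def pderiv : List ℤ → List ℤ
  | [] => []
  | _ :: l => addMul 1 l (0 :: pderiv l)

/-- The sum of the absolute values of the coefficients. -/
def sumAbs : List ℤ → ℕ
  | [] => 0
  | a :: l => a.natAbs + sumAbs l

/-- The value at the integer `c`. -/
def evalAt (c : ℤ) : List ℤ → ℤ
  | [] => 0
  | a :: l => a + c * evalAt c l

/-- A bound for the negative part of the values on `[-1, 1]`. -/
def negBound : List ℤ → ℕ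
  | [] => 0
  | a :: l => ((sumAbs l : ℤ) - a).toNat

lemma pev_addMul (a : ℤ) (m r : List ℤ) (s : ℝ) :
    pev (addMul a m r) s = a * pev m s + pev r s := by
  induction m generalizing r with
  | nil => simp [addMul, pev]
  | cons b m ih =>
    cases r with
    | nil => simp only [addMul, pev, ih]; push_cast; ring
    | cons c r => simp only [addMul, pev, ih]; push_cast; ring

lemma pev_pmul (l m : List ℤ) (s : ℝ) : pev (pmul l m) s = pev l s * pev m s := by
  induction l with
  | nil => simp [pmul, pev]
  | cons a l ih => rw [pmul, pev_addMul, pev, pev, ih]; push_cast; ring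

lemma pev_ppow (l : List ℤ) (k : ℕ) (s : ℝ) : pev (ppow l k) s = pev l s ^ k := by
  induction k with
  | zero => simp [ppow, pev]
  | succ k ih => rw [ppow, pev_pmul, ih]; ring

lemma hasDerivAt_pev (l : List ℤ) (s : ℝ) : HasDerivAt (pev l) (pev (pderiv l) s) s := by
  induction l with
  | nil => exact hasDerivAt_const s 0
  | cons a l ih =>
    have h := ((hasDerivAt_id s).mul ih).const_add (a : ℝ)
    refine (h : HasDerivAt (pev (a :: l)) _ s).congr_deriv ?_
    rw [pderiv, pev_addMul, pev]; simp

lemma abs_pev_le (l : List ℤ) {s : ℝ} (hs : |s| ≤ 1) : |pev l s| ≤ sumAbs l := by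
  induction l with
  | nil => simp [pev, sumAbs]
  | cons a l ih =>
    have e : (sumAbs (a :: l) : ℝ) = |(a : ℝ)| + sumAbs l := by
      rw [sumAbs]; push_cast; rw [Nat.cast_natAbs, Int.cast_abs]
    rw [e, pev]
    calc |(a : ℝ) + s * pev l s| ≤ |(a : ℝ)| + |s| * |pev l s| := by
          rw [← abs_mul]; exact abs_add_le _ _
      _ ≤ |(a : ℝ)| + 1 * sumAbs l := by gcongr
      _ = _ := by ring

lemma neg_negBound_le (l : List ℤ) {s : ℝ} (hs : |s| ≤ 1) : -(negBound l : ℝ) ≤ pev l s := by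
  cases l with
  | nil => simp [pev, negBound]
  | cons a l =>
    have h1 : ((sumAbs l : ℝ)) - a ≤ (negBound (a :: l) : ℝ) := by
      have : (sumAbs l : ℤ) - a ≤ (((sumAbs l : ℤ) - a).toNat : ℤ) := Int.self_le_toNat _
      exact_mod_cast this
    have h2 := abs_pev_le l hs
    have h3 : |s * pev l s| ≤ sumAbs l := by
      rw [abs_mul]
      calc _ ≤ 1 * (sumAbs l : ℝ) := by gcongr
        _ = _ := one_mul _
    rw [pev]
    linarith [(abs_le.1 h3).1]

lemma evalAt_cast (c : ℤ) (l : List ℤ) : (evalAt c l : ℝ) = pev l c := by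
  induction l with
  | nil => simp [evalAt, pev]
  | cons a l ih => rw [evalAt]; push_cast; rw [ih, pev]

/-! ### Sums of absolute values from a single value

The coefficients of an integer polynomial, all at most `K` in absolute value, are the balanced
digits of its value at `2 * K + 1`. -/

lemma sumAbs_addMul_le (a : ℤ) (m r : List ℤ) :
    sumAbs (addMul a m r) ≤ a.natAbs * sumAbs m + sumAbs r := by
  induction m generalizing r with
  | nil => simp [addMul, sumAbs]
  | cons b m ih =>
    cases r with
    | nil =>
      have := ih []
      simp only [addMul, sumAbs, Int.natAbs_mul, mul_add] at this ⊢
      omega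
    | cons c r =>
      have := ih r
      have h2 := Int.natAbs_add_le (a * b) c
      simp only [addMul, sumAbs, Int.natAbs_mul, mul_add] at this h2 ⊢
      omega

lemma sumAbs_pmul_le (l m : List ℤ) : sumAbs (pmul l m) ≤ sumAbs l * sumAbs m := by
  induction l with
  | nil => simp [pmul, sumAbs]
  | cons a l ih =>
    refine (sumAbs_addMul_le _ _ _).trans ?_
    simp only [sumAbs, Int.natAbs_zero, zero_add, add_mul]
    omega

lemma sumAbs_ppow_le (l : List ℤ) (k : ℕ) : sumAbs (ppow l k) ≤ sumAbs l ^ k := by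
  induction k with
  | zero => simp [ppow, sumAbs]
  | succ k ih =>
    refine (sumAbs_pmul_le _ _).trans ?_
    rw [pow_succ, mul_comm]
    gcongr

lemma length_addMul (a : ℤ) (m r : List ℤ) :
    (addMul a m r).length = max m.length r.length := by
  induction m generalizing r with
  | nil => simp [addMul]
  | cons b m ih => cases r <;> simp [addMul, ih]

lemma length_pmul_le (l m : List ℤ) : (pmul l m).length ≤ l.length + m.length := by
  induction l with
  | nil => simp [pmul]
  | cons a l ih => rw [pmul, length_addMul, List.length_cons, List.length_cons]; omega

lemma length_ppow_le (l : List ℤ) (k : ℕ) : (ppow l k).length ≤ l.length * k + 1 := by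
  induction k with
  | zero => simp [ppow]
  | succ k ih =>
    refine (length_pmul_le _ _).trans ?_
    rw [Nat.mul_succ]; omega

lemma length_pderiv_le (l : List ℤ) : (pderiv l).length ≤ l.length := by
  induction l with
  | nil => simp [pderiv]
  | cons a l ih => rw [pderiv, length_addMul, List.length_cons, List.length_cons]; omega

/-- The number all of whose `L` digits in base `2 * K + 1` are `K`. -/
def digitShift (K : ℕ) : ℕ → ℕ
  | 0 => 0
  | L + 1 => K + (2 * K + 1) * digitShift K L

/-- The sum of the distances from `K` of the first `L` digits of `n` in base `2 * K + 1`. -/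
def digitDist (K : ℕ) : ℕ → ℕ → ℕ
  | 0, _ => 0
  | L + 1, n => (n % (2 * K + 1) - K) + (K - n % (2 * K + 1)) + digitDist K L (n / (2 * K + 1))

/-- Adding `K` to every coefficient makes all digits lie in `[0, 2K]`, so they can be read off in
base `2K + 1`. The residual polynomial can then be treated through one large integer, with one
integer power instead of repeated polynomial products. -/
lemma digitDist_eq_sumAbs {K L : ℕ} {l : List ℤ} (hK : sumAbs l ≤ K) (hL : l.length ≤ L) :
    digitDist K L (evalAt (2 * K + 1 : ℕ) l + digitShift K L).toNat = sumAbs l := by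
  suffices H : ∃ n : ℕ, (n : ℤ) = evalAt (2 * K + 1 : ℕ) l + digitShift K L ∧
      digitDist K L n = sumAbs l by
    obtain ⟨n, h1, h2⟩ := H
    rw [← h1, Int.toNat_natCast, h2]
  induction L generalizing l with
  | zero =>
    obtain rfl : l = [] := List.length_eq_zero_iff.1 (by omega)
    exact ⟨0, by simp [evalAt, digitShift], by simp [digitDist, sumAbs]⟩
  | succ L ih =>
    obtain ⟨a, m, hv, hs, hm, haK⟩ : ∃ (a : ℤ) (m : List ℤ),
        evalAt (2 * K + 1 : ℕ) l = a + (2 * K + 1 : ℕ) * evalAt (2 * K + 1 : ℕ) m ∧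
        sumAbs l = a.natAbs + sumAbs m ∧ m.length ≤ L ∧ a.natAbs + sumAbs m ≤ K := by
      cases l with
      | nil => exact ⟨0, [], by simp [evalAt], by simp [sumAbs], by simp, by simp [sumAbs]⟩
      | cons a m => exact ⟨a, m, rfl, rfl, by simpa using hL, hK⟩
    obtain ⟨n, hn, hd⟩ := ih (by omega) hm
    obtain ⟨r, hr⟩ : ∃ r : ℕ, (r : ℤ) = a + K := ⟨(a + K).toNat, by omega⟩
    refine ⟨r + (2 * K + 1) * n, ?_, ?_⟩
    · rw [hv, digitShift]
      push_cast at hn ⊢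
      rw [hr, hn]; ring
    · have h1 : (r + (2 * K + 1) * n) % (2 * K + 1) = r := by
        rw [Nat.add_mul_mod_self_left, Nat.mod_eq_of_lt (by omega)]
      have h2 : (r + (2 * K + 1) * n) / (2 * K + 1) = n := by
        rw [Nat.add_mul_div_left _ _ (by omega), Nat.div_eq_of_lt (by omega), zero_add]
      rw [digitDist, h1, h2, hd, hs]
      omega

/-! ### Piecewise polynomial approximation of the fluid limit -/

/-- Values of the fluid limit are approximated by integer multiples of `1 / scale`. -/
def scale : ℕ := 10 ^ 12

lemma scale_pos : (0 : ℝ) < scale := by norm_num [scale]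

/-- The coefficients of `scale ^ k` times the residual of
`P' = G * (2 - ((P - Q) / scale) ^ k)`. -/
def residPoly (k G : ℕ) (P Q : List ℤ) : List ℤ :=
  addMul (scale ^ k : ℕ) (pderiv P)
    (addMul G (ppow (addMul (-1) Q P) k) [-(2 * G * scale ^ k : ℕ)])

/-- The sum of the absolute values of the coefficients of `residPoly`, computed from its value at
a single point. -/
def residSum (k G : ℕ) (P Z : List ℤ) : ℕ :=
  let D := pderiv P
  let K := scale ^ k * sumAbs D + (G * sumAbs Z ^ k + 2 * G * scale ^ k)
  let L := Z.length * k + 1 + P.length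
  digitDist K L ((scale ^ k : ℕ) * evalAt (2 * K + 1 : ℕ) D +
    (G * evalAt (2 * K + 1 : ℕ) Z ^ k - (2 * G * scale ^ k : ℕ)) + digitShift K L).toNat

lemma residSum_eq (k G : ℕ) (P Q : List ℤ) :
    residSum k G P (addMul (-1) Q P) = sumAbs (residPoly k G P Q) := by
  set Z := addMul (-1) Q P with hZ
  set K := scale ^ k * sumAbs (pderiv P) + (G * sumAbs Z ^ k + 2 * G * scale ^ k) with hK
  have h1 : sumAbs (residPoly k G P Q) ≤ K := by
    refine (sumAbs_addMul_le _ _ _).trans ?_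
    rw [Int.natAbs_natCast, hK]
    gcongr
    refine (sumAbs_addMul_le _ _ _).trans ?_
    rw [Int.natAbs_natCast]
    gcongr
    · exact sumAbs_ppow_le _ _
    · rw [sumAbs, sumAbs, Int.natAbs_neg, Int.natAbs_natCast, add_zero]
  have h2 : (residPoly k G P Q).length ≤ Z.length * k + 1 + P.length := by
    have h3 := length_pderiv_le P
    have h4 := length_ppow_le Z k
    rw [residPoly, length_addMul, length_addMul, List.length_singleton, ← hZ]
    omega
  have h3 : evalAt (2 * K + 1 : ℕ) (residPoly k G P Q) =
      (scale ^ k : ℕ) * evalAt (2 * K + 1 : ℕ) (pderiv P) +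
        (G * evalAt (2 * K + 1 : ℕ) Z ^ k - (2 * G * scale ^ k : ℕ)) := by
    have : ((evalAt (2 * K + 1 : ℕ) (residPoly k G P Q) : ℤ) : ℝ) =
        (((scale ^ k : ℕ) * evalAt (2 * K + 1 : ℕ) (pderiv P) +
          (G * evalAt (2 * K + 1 : ℕ) Z ^ k - (2 * G * scale ^ k : ℕ)) : ℤ) : ℝ) := by
      rw [evalAt_cast, residPoly, pev_addMul, pev_addMul, pev_ppow]
      simp only [Int.cast_add, Int.cast_sub, Int.cast_mul, Int.cast_pow, evalAt_cast, pev]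
      push_cast
      ring
    exact_mod_cast this
  rw [← digitDist_eq_sumAbs h1 h2, h3]
  rfl

/-- A bound for `scale ^ k` times the residual of `P' = G * (2 - ((P - Q) / scale) ^ k)` on
`[-1, 1]`, including the effect of negative values of `P - Q`. -/
def resid (k G : ℕ) (P Q : List ℤ) : ℕ :=
  let Z := addMul (-1) Q P
  residSum k G P Z + if k % 2 = 1 then 0 else G * negBound Z ^ k

/-- Approximate gaps can be slightly negative. Odd powers are still monotone; for even `k` the
violation is at most `δ ^ k`. -/
lemma pow_le_pow_add {k : ℕ} {a b δ : ℝ} (hab : a ≤ b) (hb : 0 ≤ b) (hδ : -δ ≤ a) (hδ0 : 0 ≤ δ) :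
    a ^ k ≤ b ^ k + if k % 2 = 1 then 0 else δ ^ k := by
  split_ifs with hk
  · have := (Nat.odd_iff.2 hk).pow_le_pow.2 hab
    linarith
  · rcases le_total 0 a with ha | ha
    · have := pow_le_pow_left₀ ha hab k
      have := pow_nonneg hδ0 k
      linarith
    · have he : Even k := Nat.even_iff.2 (by omega)
      have h1 : (-a) ^ k ≤ δ ^ k := pow_le_pow_left₀ (by linarith) (by linarith) k
      rw [he.neg_pow] at h1
      have := pow_nonneg hb k
      linarith

section Residual

variable {k G e : ℕ} {P Q : List ℤ}

lemma abs_residual_add_le (he : resid k G P Q < e * scale ^ k) {s : ℝ} (hs : |s| ≤ 1) :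
    |pev (pderiv P) s - G * (2 - ((pev P s - pev Q s) / scale) ^ k)| +
      G * (if k % 2 = 1 then 0 else ((negBound (addMul (-1) Q P) : ℝ) / scale) ^ k) < e := by
  have hM := pow_pos scale_pos k
  set Z := addMul (-1) Q P with hZ
  set R := residPoly k G P Q with hR
  have eR : pev R s =
      (pev (pderiv P) s - G * (2 - ((pev P s - pev Q s) / scale) ^ k)) * scale ^ k := by
    rw [hR, residPoly, pev_addMul, pev_addMul, pev_ppow, pev_addMul, pev, pev, div_pow]
    push_cast
    field_simp
    ring
  have h1 := abs_pev_le R hs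
  rw [eR, abs_mul, abs_of_pos hM] at h1
  have h2 : ((sumAbs R + if k % 2 = 1 then 0 else G * negBound Z ^ k : ℕ) : ℝ) <
      (e * scale ^ k : ℕ) := by
    rw [resid, residSum_eq] at he
    exact_mod_cast he
  have h3 : (G : ℝ) * (if k % 2 = 1 then 0 else ((negBound Z : ℝ) / scale) ^ k) * scale ^ k =
      ((if k % 2 = 1 then 0 else G * negBound Z ^ k : ℕ) : ℝ) := by
    split_ifs
    · simp
    · push_cast; rw [div_pow]; field_simp
  refine lt_of_mul_lt_mul_right ?_ hM.le
  rw [add_mul, h3]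
  push_cast at h2 ⊢
  linarith

variable {X : ℕ → ℝ} {d : ℕ → ℝ → ℝ} {j : ℕ} {x : ℝ} {err : ℝ}

lemma hasDerivWithinAt_rescale {f : ℝ → ℝ} {m g s : ℝ} (hg : 0 ≤ g)
    (h : HasDerivWithinAt f m (Ici (x + g * (s + 1))) (x + g * (s + 1))) :
    HasDerivWithinAt (fun s => scale * f (x + g * (s + 1))) (scale * (m * g)) (Ici s) s := by
  have h1 : HasDerivWithinAt (fun s => x + g * (s + 1)) g (Ici s) s := by
    have := (((hasDerivAt_id s).add_const 1).const_mul g).const_add x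
    simpa using this.hasDerivWithinAt
  exact (h.comp s h1 fun y hy => by
    simp only [mem_Ici] at hy ⊢
    gcongr).const_mul _

lemma continuousOn_rescale {f : ℝ → ℝ} {g : ℝ} (hx : 0 ≤ x) (hg : 0 ≤ g)
    (h : ContinuousOn f (Ici 0)) :
    ContinuousOn (fun s => scale * f (x + g * (s + 1))) (Icc (-1) 1) :=
  continuousOn_const.mul (h.comp (by fun_prop) fun s hs => by
    have := mul_nonneg hg (by linarith [hs.1] : 0 ≤ s + 1)
    simp only [mem_Ici]
    linarith)

lemma hasDerivAt_band (P : List ℤ) (err e s : ℝ) :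
    HasDerivAt (fun s => pev P s + (err + e * (s + 1))) (pev (pderiv P) s + e) s := by
  have := (((hasDerivAt_id s).add_const 1).const_mul e).const_add err
  exact ((hasDerivAt_pev P s).add this).congr_deriv (by simp)

/-- The polynomial plus a band of slope `e` is a strict supersolution. Both components carry the
same band, so at a contact point the bands cancel in the difference and the true gap is at least `(P
- Q) / scale`; the error thus grows additively, by `2 * e` per step. The variable `s` in `[-1, 1]`
rescales a time step of length `2 * G / scale`. No restriction to times before saturation is needed
in this direction. -/
lemma IsFluid.le_pev (hF : IsFluid k X d) (hx : 0 ≤ x) (he : resid k G P Q < e * scale ^ k)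
    (hQ : ∀ s ∈ Icc (-1 : ℝ) 1,
      scale * d j (x + G / scale * (s + 1)) ≤ pev Q s + (err + e * (s + 1)))
    (hP : scale * d (j + 1) x ≤ pev P (-1) + err) {s : ℝ} (hs : s ∈ Icc (-1 : ℝ) 1) :
    scale * d (j + 1) (x + G / scale * (s + 1)) ≤ pev P s + (err + e * (s + 1)) := by
  have hM := scale_pos
  have hg : (0 : ℝ) ≤ G / scale := by positivity
  have hτ : ∀ s ∈ Icc (-1 : ℝ) 1, 0 ≤ x + G / scale * (s + 1) := fun s hs =>
    add_nonneg hx (mul_nonneg hg (by linarith [hs.1]))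
  obtain ⟨m, hm⟩ := hF.exists_right_deriv_le j
  refine image_le_of_deriv_right_lt_deriv_boundary
    (f := fun s => scale * d (j + 1) (x + G / scale * (s + 1)))
    (continuousOn_rescale hx hg (hF.saturating (j + 1)).cont)
    (fun s hs => hasDerivWithinAt_rescale hg (hm _ (hτ s (Ico_subset_Icc_self hs))).1)
    (by simpa using hP) (fun s => hasDerivAt_band P err e s) (fun s hs hB => ?_) hs
  have hs' := Ico_subset_Icc_self hs
  have hz := hF.gap_mem j (hτ s hs')
  have hmle := (hm _ (hτ s hs')).2
  have h1 := hQ s hs'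
  set z := d (j + 1) (x + G / scale * (s + 1)) - d j (x + G / scale * (s + 1)) with hzdef
  have hZz : (pev P s - pev Q s) / scale ≤ z := by
    rw [div_le_iff₀ hM, hzdef]; linarith only [h1, hB]
  have habs : |s| ≤ 1 := abs_le.2 hs'
  have hneg : -((negBound (addMul (-1) Q P) : ℝ) / scale) ≤ (pev P s - pev Q s) / scale := by
    rw [← neg_div]
    gcongr
    have := neg_negBound_le (addMul (-1) Q P) habs
    rw [pev_addMul] at this
    push_cast at this
    linarith
  have h2 := pow_le_pow_add (k := k) hZz hz.1 hneg (by positivity)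
  have h3 := abs_residual_add_le he habs
  have h4 := (abs_le.1 (le_refl |pev (pderiv P) s -
    G * (2 - ((pev P s - pev Q s) / scale) ^ k)|)).1
  have h5 := mul_le_mul_of_nonneg_left h2 (Nat.cast_nonneg (α := ℝ) G)
  have h6 : scale * (m (x + G / scale * (s + 1)) * (G / scale)) ≤ G * (2 - z ^ k) := by
    calc _ = G * m (x + G / scale * (s + 1)) := by field_simp
      _ ≤ _ := by gcongr
  linarith only [h3, h4, h5, h6]

/-- The mirror image of `IsFluid.le_pev`. The equation itself is used here, so the step must end
before `X (j + 1)`. The nonnegative true gap is now the smaller one, so negative values of `P - Q`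
do no harm. -/
lemma IsFluid.pev_le (hF : IsFluid k X d) (hx : 0 ≤ x) (he : resid k G P Q < e * scale ^ k)
    (hX : x + G / scale * 2 < X (j + 1))
    (hQ : ∀ s ∈ Icc (-1 : ℝ) 1,
      pev Q s - (err + e * (s + 1)) ≤ scale * d j (x + G / scale * (s + 1)))
    (hP : pev P (-1) - err ≤ scale * d (j + 1) x) {s : ℝ} (hs : s ∈ Icc (-1 : ℝ) 1) :
    pev P s - (err + e * (s + 1)) ≤ scale * d (j + 1) (x + G / scale * (s + 1)) := by
  have hM := scale_pos
  have hg : (0 : ℝ) ≤ G / scale := by positivity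
  have hτ : ∀ s ∈ Icc (-1 : ℝ) 1, 0 ≤ x + G / scale * (s + 1) := fun s hs =>
    add_nonneg hx (mul_nonneg hg (by linarith [hs.1]))
  have hband : ∀ s, HasDerivAt (fun s => pev P s - (err + e * (s + 1)))
      (pev (pderiv P) s - e) s := fun s => by
    have := hasDerivAt_band P (-err) (-e) s
    refine (this.congr_deriv (by ring)).congr_of_eventuallyEq (Eventually.of_forall fun y => ?_)
    simp only
    ring
  refine image_le_of_deriv_right_lt_deriv_boundary'
    (B := fun s => scale * d (j + 1) (x + G / scale * (s + 1)))
    (fun s _ => (hband s).continuousAt.continuousWithinAt)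
    (fun s _ => (hband s).hasDerivWithinAt) (by simpa using hP)
    (continuousOn_rescale hx hg (hF.saturating (j + 1)).cont)
    (fun s hs => hasDerivWithinAt_rescale hg ((hF.follows j).right_deriv _
      ⟨hτ s (Ico_subset_Icc_self hs), lt_of_le_of_lt ?_ hX⟩)) (fun s hs hB => ?_) hs
  · have : G / scale * (s + 1) ≤ G / scale * 2 :=
      mul_le_mul_of_nonneg_left (by linarith [hs.2]) hg
    linarith
  have hs' := Ico_subset_Icc_self hs
  have hz := hF.gap_mem j (hτ s hs')
  have h1 := hQ s hs'
  set z := d (j + 1) (x + G / scale * (s + 1)) - d j (x + G / scale * (s + 1)) with hzdef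
  have hZz : z ≤ (pev P s - pev Q s) / scale := by
    rw [le_div_iff₀ hM, hzdef]; linarith only [h1, hB]
  have habs : |s| ≤ 1 := abs_le.2 hs'
  have h2 := pow_le_pow_left₀ hz.1 hZz k
  have h3 := abs_residual_add_le he habs
  have h4 := (abs_le.1 (le_refl |pev (pderiv P) s -
    G * (2 - ((pev P s - pev Q s) / scale) ^ k)|)).2
  have h5 := mul_le_mul_of_nonneg_left h2 (Nat.cast_nonneg (α := ℝ) G)
  have h6 : (scale : ℝ) * ((2 - z ^ k) * (G / scale)) = G * (2 - z ^ k) := by field_simp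
  have h7 : (0 : ℝ) ≤ G * (if k % 2 = 1 then 0 else
      ((negBound (addMul (-1) Q P) : ℝ) / scale) ^ k) :=
    mul_nonneg (Nat.cast_nonneg _) (by split_ifs <;> positivity)
  rw [h6]
  linarith only [h3, h4, h5, h7]

end Residual

/-! ### Computing the approximation -/

/-- For a polynomial with the value `r` at `10 ^ 70`: the coefficients of its multiple by `G / D`,
divided by `i`, `i + 1`, … and rounded. -/
def integrate (G D : ℕ) : ℕ → ℤ → ℕ → List ℤ
  | 0, _, _ => []
  | N + 1, r, i =>
    G * ((r + 5 * 10 ^ 69) % 10 ^ 70 - 5 * 10 ^ 69) / ((D * i : ℕ) : ℤ) ::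
      integrate G D N ((r + 5 * 10 ^ 69) / 10 ^ 70) (i + 1)

/-- A step of Picard's iteration, with the initial values `vs` at `-1`. -/
def picardStep (k G N : ℕ) : List ℤ → List ℤ → List (List ℤ) → List (List ℤ)
  | v :: vs, Q, P :: Ps =>
    let t := integrate G (scale ^ k)
      N (2 * (scale : ℤ) ^ k - evalAt (10 ^ 70) (addMul (-1) Q P) ^ k) 1
    ((v + evalAt (-1) t) :: t) :: picardStep k G N vs P Ps
  | _, _, _ => []

/-- Approximate solutions of degree `N`, with the initial values `vs` at `-1`. -/
def approx (k G : ℕ) (b : ℤ) (vs : List ℤ) : ℕ → List (List ℤ)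
  | 0 => vs.map fun v => [v]
  | N + 1 => picardStep k G (N + 1) vs [b] (approx k G b vs N)

/-- A strict bound for the residuals of all components. -/
def residMax (k G : ℕ) : List ℤ → List (List ℤ) → ℕ
  | _, [] => 0
  | Q, P :: Ps => max (resid k G P Q / scale ^ k + 1) (residMax k G P Ps)

/-- One step of length `2 * G / scale`: from approximate values and an error bound to the next
ones, provided that the first component stays below `b + scale`. -/
def advance (k G N : ℕ) (b : ℤ) (s : List ℤ × ℕ) : Option (List ℤ × ℕ) :=
  let Ps := approx k G b s.1 N
  let e := s.2 + 2 * residMax k G [b] Ps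
  if Ps.map (evalAt (-1)) = s.1 ∧ (Ps.map (evalAt 1)).headD (b + scale) + e < b + scale then
    some (Ps.map (evalAt 1), e) else none

/-- `m` steps. -/
def runPhase (k G N : ℕ) (b : ℤ) : ℕ → List ℤ × ℕ → Option (List ℤ × ℕ)
  | 0, s => some s
  | m + 1, s => match advance k G N b s with
    | none => none
    | some u => runPhase k G N b m u

/-- Phase `q` ends at the time `X (q + 1)`, which is shown to be close to `c / 10 ^ 5`, for the
entries `(G, c)` of the list in turn. -/
def verify (k m N : ℕ) : ℕ → ℕ → List ℤ × ℕ → List (ℕ × ℕ) → Bool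
  | _, _, _, [] => true
  | q, T, s, (G, c) :: ps => match runPhase k G N (q * scale : ℕ) m s with
    | some (v :: vs, e) =>
      let w := (((q + 1) * scale : ℕ) - v).toNat + e
      decide (c * 10 ^ 7 ≤ T + 2 * m * G + 5 * 10 ^ 6) &&
        (decide (T + 2 * m * G + w ≤ c * 10 ^ 7 + 5 * 10 ^ 6) &&
          verify k m N (q + 1) (T + 2 * m * G) (vs, w) ps)
    | _ => false

/-! ### Soundness -/

/-- The integers in the list approximate `scale * d j x`, `scale * d (j + 1) x`, … -/
def Close (d : ℕ → ℝ → ℝ) (x : ℝ) (e : ℕ) : ℕ → List ℤ → Prop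
  | _, [] => True
  | j, v :: vs => |scale * d j x - v| ≤ e ∧ Close d x e (j + 1) vs

lemma Close.mono {d : ℕ → ℝ → ℝ} {x : ℝ} {e e' : ℕ} (h : e ≤ e') {j : ℕ} {vs : List ℤ}
    (hc : Close d x e j vs) : Close d x e' j vs := by
  induction vs generalizing j with
  | nil => trivial
  | cons v vs ih => exact ⟨hc.1.trans (by exact_mod_cast h), ih hc.2⟩

lemma lt_mul_of_div_add_one_le {a b e : ℕ} (hb : 0 < b) (h : a / b + 1 ≤ e) : a < e * b :=
  (Nat.div_lt_iff_lt_mul hb).1 h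

variable {k : ℕ} {X : ℕ → ℝ} {d : ℕ → ℝ → ℝ}

/-- The polynomials are arbitrary: only their residuals and initial values enter, so nothing has to
be proved about how Picard's iteration rounds its coefficients. The band of each component serves as
the input for the next. -/
lemma IsFluid.close_step (hF : IsFluid k X d) {G err e : ℕ} {x : ℝ} (hx : 0 ≤ x)
    {Ps : List (List ℤ)} {Q : List ℤ} {j : ℕ} (he : residMax k G Q Ps ≤ e)
    (hX : x + G / scale * 2 < X (j + 1))
    (hQ : ∀ s ∈ Icc (-1 : ℝ) 1,
      |scale * d j (x + G / scale * (s + 1)) - pev Q s| ≤ err + e * (s + 1))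
    (hc : Close d x err (j + 1) (Ps.map (evalAt (-1)))) :
    Close d (x + G / scale * 2) (err + 2 * e) (j + 1) (Ps.map (evalAt 1)) := by
  induction Ps generalizing Q j with
  | nil => trivial
  | cons P Ps ih =>
    have he1 : resid k G P Q < e * scale ^ k :=
      lt_mul_of_div_add_one_le (pow_pos (by norm_num [scale]) k) ((le_max_left _ _).trans he)
    have hstart := abs_le.1 hc.1
    rw [evalAt_cast] at hstart
    push_cast at hstart
    have hP : ∀ s ∈ Icc (-1 : ℝ) 1,
        |scale * d (j + 1) (x + G / scale * (s + 1)) - pev P s| ≤ err + e * (s + 1) := by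
      intro s hs
      have h1 := hF.le_pev (err := err) hx he1
        (fun s hs => by linarith [(abs_le.1 (hQ s hs)).2]) (by linarith [hstart.2]) hs
      have h2 := hF.pev_le (err := err) hx he1 hX
        (fun s hs => by linarith [(abs_le.1 (hQ s hs)).1]) (by linarith [hstart.1]) hs
      exact abs_le.2 ⟨by linarith, by linarith⟩
    refine ⟨?_, ih ((le_max_right _ _).trans he) (hX.trans (hF.time_lt _)) hP hc.2⟩
    have := hP 1 (by norm_num)
    rw [evalAt_cast]
    push_cast
    norm_num at this ⊢
    linarith

/-- The state `s` describes the fluid limit at the time `T / scale` in phase `q`. -/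
def Tracks (X : ℕ → ℝ) (d : ℕ → ℝ → ℝ) (q T : ℕ) (s : List ℤ × ℕ) : Prop :=
  (T : ℝ) / scale ≤ X (q + 1) ∧ (q * scale : ℝ) - s.2 ≤ scale * d q (T / scale) ∧
    Close d (T / scale) s.2 (q + 1) s.1

lemma IsFluid.tracks_advance (hF : IsFluid k X d) {q T G N : ℕ} {s s' : List ℤ × ℕ}
    (hT : Tracks X d q T s) (h : advance k G N (q * scale : ℕ) s = some s') :
    Tracks X d q (T + 2 * G) s' := by
  have hM := scale_pos
  obtain ⟨-, hq, hc⟩ := hT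
  obtain ⟨vs, err⟩ := s
  simp only [advance] at h
  set Ps := approx k G (q * scale : ℕ) vs N with hPs
  set e := residMax k G [((q * scale : ℕ) : ℤ)] Ps with he
  split_ifs at h with hcond
  obtain ⟨hvs, hlt⟩ := hcond
  obtain rfl := Option.some.inj h
  have hx : (0 : ℝ) ≤ T / scale := by positivity
  have eT : ((T + 2 * G : ℕ) : ℝ) / scale = T / scale + G / scale * 2 := by push_cast; ring
  have hsat := hF.saturating q
  have hg : (0 : ℝ) ≤ G / scale := by positivity
  have hQ : ∀ s ∈ Icc (-1 : ℝ) 1, |scale * d q (T / scale + G / scale * (s + 1)) -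
      pev [((q * scale : ℕ) : ℤ)] s| ≤ err + e * (s + 1) := by
    intro s hs
    have hs0 : 0 ≤ s + 1 := by linarith [hs.1]
    have h0 := mul_nonneg hg hs0
    have h1 := hsat.le (add_nonneg hx h0)
    have h2 := (hsat.monotone_sub hx (by linarith :
      (T : ℝ) / scale ≤ T / scale + G / scale * (s + 1))).1
    have h3 := mul_le_mul_of_nonneg_left h1 hM.le
    have h4 := mul_nonneg hM.le h2
    have h5 : (0 : ℝ) ≤ e * (s + 1) := by positivity
    have h6 : (0 : ℝ) ≤ err := Nat.cast_nonneg _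
    simp only [pev, mul_zero, add_zero]
    push_cast
    simp only at hq
    exact abs_le.2 ⟨by linarith, by linarith⟩
  have hX : (T : ℝ) / scale + G / scale * 2 < X (q + 1) := by
    cases hP : Ps with
    | nil =>
      rw [hP] at hlt
      -- The default value `b + scale` in `advance` makes the test fail for an empty list.
      simp only [List.map_nil, List.headD_nil] at hlt
      omega
    | cons P Ps' =>
      rw [hP] at hlt hvs
      simp only [List.map_cons, List.headD_cons] at hlt
      rw [← hvs] at hc
      have hstart := abs_le.1 hc.1
      rw [evalAt_cast] at hstart
      push_cast at hstart
      have he1 : resid k G P [((q * scale : ℕ) : ℤ)] < e * scale ^ k := by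
        refine lt_mul_of_div_add_one_le (pow_pos (by norm_num [scale]) k) ?_
        rw [he, hP]
        exact le_max_left _ _
      -- The upper band is valid without knowing that the step ends before saturation. Since it
      -- stays below `q + 1` at the end of the step, saturation cannot have occurred.
      have h1 := hF.le_pev (err := err) hx he1
        (fun s hs => by linarith [(abs_le.1 (hQ s hs)).2]) (by linarith [hstart.2])
        (right_mem_Icc.2 (by norm_num))
      by_contra hc'
      rw [show ((1 : ℝ) + 1) = 2 by norm_num,
        (hF.saturating (q + 1)).saturated _ (not_lt.1 hc')] at h1
      have h2 : ((evalAt 1 P : ℤ) : ℝ) + ((err + 2 * e : ℕ) : ℝ) <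
          ((q * scale : ℕ) : ℝ) + scale := by exact_mod_cast hlt
      rw [evalAt_cast] at h2
      push_cast at h1 h2
      linarith
  refine ⟨by rw [eT]; exact hX.le, ?_, ?_⟩
  · rw [eT]
    have h2 := (hsat.monotone_sub hx (by linarith [mul_nonneg hg zero_le_two] :
      (T : ℝ) / scale ≤ T / scale + G / scale * 2)).1
    have h4 := mul_nonneg hM.le h2
    have h6 : (0 : ℝ) ≤ e := Nat.cast_nonneg _
    simp only at hq ⊢
    push_cast
    linarith
  · rw [eT]
    exact hF.close_step hx le_rfl hX hQ (by rw [hvs]; exact hc)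

lemma IsFluid.tracks_runPhase (hF : IsFluid k X d) {q G N m : ℕ} {T : ℕ} {s s' : List ℤ × ℕ}
    (hT : Tracks X d q T s) (h : runPhase k G N (q * scale : ℕ) m s = some s') :
    Tracks X d q (T + 2 * m * G) s' := by
  induction m generalizing T s with
  | zero =>
    obtain rfl := Option.some.inj h
    simpa using hT
  | succ m ih =>
    rw [runPhase] at h
    split at h
    · exact absurd h (by simp)
    · rename_i s₁ hs₁
      have := ih (hF.tracks_advance hT hs₁) h
      rwa [show T + 2 * G + 2 * m * G = T + 2 * (m + 1) * G by ring] at this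

/-- The last step of a phase ends no later than `X (q + 1)`, when `d (q + 1)` misses `q + 1` by at
most `w / scale`; a slope of at least 1 then gives `X (q + 1) ≤ (T' + w) / scale`. The next phase
starts at `T'` without waiting for the exact end: `Tracks` only needs `d (q + 1)` to be within the
error of the constant `q + 1`. In units of `1 / scale`, a table unit is `10 ^ 7` and the tolerance
is `5 * 10 ^ 6`. -/
lemma IsFluid.abs_time_sub_le (hF : IsFluid k X d) {m N q T : ℕ} {s : List ℤ × ℕ}
    (hT : Tracks X d q T s) {ps : List (ℕ × ℕ)} (h : verify k m N q T s ps = true) (i : ℕ)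
    (hi : i < ps.length) : |X (q + i + 1) - (ps[i].2 : ℝ) / 10 ^ 5| ≤ 5 / 10 ^ 6 := by
  induction ps generalizing q T s i with
  | nil => simp at hi
  | cons p ps ih =>
    obtain ⟨G, c⟩ := p
    have hM := scale_pos
    rw [verify] at h
    split at h
    swap
    · exact absurd h (by simp)
    rename_i v vs e hrun
    simp only [Bool.and_eq_true, decide_eq_true_eq] at h
    obtain ⟨h1, h2, h3⟩ := h
    obtain ⟨hX, hq, hc⟩ := hF.tracks_runPhase hT hrun
    set T' := T + 2 * m * G with hT'
    set w := (((q + 1) * scale : ℕ) - v).toNat + e with hw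
    have hx : (0 : ℝ) ≤ (T' : ℝ) / scale := by positivity
    have hwle : (((q + 1) * scale : ℕ) : ℤ) - v + e ≤ w := by
      rw [hw]; push_cast; linarith [Int.self_le_toNat (((q : ℤ) + 1) * scale - v)]
    have hwle' : ((q + 1 : ℕ) : ℝ) * scale - v + e ≤ w := by exact_mod_cast hwle
    have hd := (abs_le.1 hc.1).1
    simp only at hd
    have hlow : ((q + 1 : ℕ) : ℝ) * scale - w ≤ scale * d (q + 1) (T' / scale) := by linarith
    have hsat := hF.saturating (q + 1)
    have hup : X (q + 1) ≤ (T' + w) / scale := by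
      have h4 := hsat.le_sub hx hX le_rfl
      rw [hsat.saturated _ le_rfl] at h4
      rw [le_div_iff₀ hM]
      have h5 := mul_le_mul_of_nonneg_left h4 hM.le
      have h6 : (scale : ℝ) * (T' / scale) = T' := by field_simp
      nlinarith
    cases i with
    | zero =>
      simp only [List.getElem_cons_zero, add_zero]
      have h1' : (c : ℝ) * 10 ^ 7 ≤ T' + 5 * 10 ^ 6 := by exact_mod_cast h1
      have h2' : (T' : ℝ) + w ≤ c * 10 ^ 7 + 5 * 10 ^ 6 := by exact_mod_cast h2
      have hs : (scale : ℝ) = 10 ^ 12 := by norm_num [scale]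
      rw [hs] at hX hup
      rw [div_le_iff₀ (by norm_num)] at hX
      rw [le_div_iff₀ (by norm_num)] at hup
      exact abs_le.2 ⟨by linarith, by linarith⟩
    | succ i =>
      have hT2 : Tracks X d (q + 1) T' (vs, w) := by
        refine ⟨hX.trans (hF.time_lt _).le, hlow, hc.2.mono ?_⟩
        rw [hw]; exact Nat.le_add_left _ _
      have := ih hT2 h3 i (by simpa using hi)
      simp only [List.getElem_cons_succ]
      rwa [show q + (i + 1) + 1 = q + 1 + i + 1 by ring]

lemma IsFluid.tracks_zero (hF : IsFluid k X d) (r : ℕ) :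
    Tracks X d 0 0 (List.replicate r 0, 0) := by
  refine ⟨?_, ?_, ?_⟩
  · simpa using (hF.saturating 1).nonneg
  · simp [hF.zero]
  · suffices H : ∀ j, Close d ((0 : ℕ) / scale : ℝ) 0 j (List.replicate r 0) from H 1
    induction r with
    | zero => exact fun _ => trivial
    | succ r ih =>
      intro j
      rw [List.replicate_succ]
      refine ⟨?_, ih _⟩
      simp [(hF.saturating j).init]

/-! ### The numerical values -/

/-- The list of initial zeros stands for `d 1, …, d 5`, and each phase drops its first component. In
each pair `(G, c)`, the total length `2 * m * G` of the `m` steps brings the time just short of the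
end of the phase in units of `1 / scale`, and `c` is the table entry times `10 ^ 5`. -/
lemma verify_one : verify 1 4 7 0 0 (List.replicate 5 0, 0)
    [(86643395223, 69315), (65823626558, 121974), (63988424977, 173164), (63309525327, 223812),
      (62984503462, 274200)] = true := by
  decide +kernel

lemma verify_two : verify 2 9 6 0 0 (List.replicate 5 0, 0)
    [(34623622584, 62323), (27875470238, 112498), (27782993241, 162508), (27778055889, 212508),
      (27777774419, 262508)] = true := by
  decide +kernel

lemma verify_three : verify 3 4 9 0 0 (List.replicate 5 0, 0)
    [(73839797783, 59072), (62511323248, 109081), (62500048504, 159081), (62499996216, 209081),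
      (62499991635, 259081)] = true := by
  decide +kernel

lemma verify_four : verify 4 5 9 0 0 (List.replicate 5 0, 0)
    [(57183362075, 57183), (50000389879, 107184), (49999998350, 157184), (49999996319, 207184),
      (49999992318, 257184)] = true := by
  decide +kernel

lemma verify_five : verify 5 6 9 0 0 (List.replicate 5 0, 0)
    [(46622721794, 55947), (41666677992, 105947), (41666664969, 155947), (41666663123, 205947),
      (41666659271, 255947)] = true := by
  decide +kernel

/-- The times at which the phases of the fluid limit end. -/
def fluidTime (k : ℕ) : ℕ → ℝ :=
  if hk : 1 ≤ k then (exists_isFluid hk).choose else fun _ => 0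

lemma exists_isFluid_fluidTime {k : ℕ} (hk : 1 ≤ k) : ∃ d, IsFluid k (fluidTime k) d := by
  rw [fluidTime, dif_pos hk]
  exact (exists_isFluid hk).choose_spec

lemma abs_fluidTime_sub_numericalTable_le (i j : Fin 5) :
    |fluidTime (j + 1) (i + 1) - numericalTable i j| ≤ 5 / 10 ^ 6 := by
  obtain ⟨d, hF⟩ := exists_isFluid_fluidTime (Nat.le_add_left 1 (j : ℕ))
  have h0 := hF.tracks_zero 5
  fin_cases j
  · have h := hF.abs_time_sub_le h0 verify_one i i.2
    fin_cases i <;> norm_num [numericalTable] at h ⊢ <;> exact h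
  · have h := hF.abs_time_sub_le h0 verify_two i i.2
    fin_cases i <;> norm_num [numericalTable] at h ⊢ <;> exact h
  · have h := hF.abs_time_sub_le h0 verify_three i i.2
    fin_cases i <;> norm_num [numericalTable] at h ⊢ <;> exact h
  · have h := hF.abs_time_sub_le h0 verify_four i i.2
    fin_cases i <;> norm_num [numericalTable] at h ⊢ <;> exact h
  · have h := hF.abs_time_sub_le h0 verify_five i i.2
    fin_cases i <;> norm_num [numericalTable] at h ⊢ <;> exact h

end SemiRandom

end

theorem mainTheorem1 :
    ∃ c : ℕ → ℕ → ℝ,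
      (∀ k ℓ : ℕ, 1 ≤ k → 1 ≤ ℓ →
        (∀ x : ℝ, SemiRandom.IsFinalTime k ℓ x ↔ x = c ℓ k) ∧
        SemiRandom.TauEq (SemiRandom.MinDegreeAtLeast ℓ) k (ENNReal.ofReal (c ℓ k)) ∧
        (ℓ : ℝ) / 2 ≤ c ℓ k) ∧
      (∀ i j : Fin 5,
        |c ((i : ℕ) + 1) ((j : ℕ) + 1) - SemiRandom.numericalTable i j| ≤ 5 / 10 ^ 6) := by
  refine ⟨fun ℓ k => SemiRandom.fluidTime k ℓ, fun k ℓ hk hℓ => ?_,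
    SemiRandom.abs_fluidTime_sub_numericalTable_le⟩
  obtain ⟨d, hF⟩ := SemiRandom.exists_isFluid_fluidTime hk
  exact ⟨hF.isFinalTime_iff ℓ, hF.tauEq hk hℓ, (hF.saturating ℓ).le_two_mul_time⟩
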